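/- Let $\kappa>0$, $m>0$, $a,Q,P\in\mathbb R$, and put $$U=r^2+a^2\cos^2\theta,\quad E_+=1+\kappa^2a^2,\quad \Delta_+(\theta)=1+\kappa^2a^2\cos^2\theta,$$ $$\Delta_+(r)=(r^2+a^2)(1-\kappa^2r^2)-2mr+Q^2+P^2 .$$ Assume that the Kerr-Newman-dS spacetime with these parameters is extreme, i.e. that there are $0<r_-<r_+$ such that the real roots of the polynomial $\Delta_+(r)$, counted with multiplicity, are the double root $r_-$, the simple root $r_+$ and the negative root $-(2r_-+r_+)$. On the exterior region $r_-<r<r_+$ consider the metric $g=-e^0\otimes e^0+e^1\otimes e^1+e^2\otimes e^2+e^3\otimes e^3$ with $$e^0=\sqrt{\tfrac{\Delta_+(r)}{U}}\Big(dt-\tfrac{a\sin^2\theta}{E_+}d\varphi\Big),\quad e^1=\sqrt{\tfrac{U}{\Delta_+(r)}}\,dr,\quad e^2=\sqrt{\tfrac{U}{\Delta_+(\theta)}}\,d\theta,\quad e^3=\sqrt{\tfrac{\Delta_+(\theta)}{U}}\sin\theta\Big(a\,dt-\tfrac{r^2+a^2}{E_+}d\varphi\Big),$$ the dual frame $e_\alpha$,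 and the electromagnetic potential $$A=-\tfrac{Qr}{U}\Big(dt-\tfrac{a\sin^2\theta}{E_+}d\varphi\Big)-\tfrac{P\cos\theta}{U}\Big(a\,dt-\tfrac{r^2+a^2}{E_+}d\varphi\Big).$$ Spinors are written as $\mathbb C^4$-valued functions in the spin frame that lifts $(e_\alpha)$. With $$\sigma^0=\begin{pmatrix}1&0\\0&1\end{pmatrix},\quad \sigma^1=\begin{pmatrix}-1&0\\0&1\end{pmatrix},\quad \sigma^2=\begin{pmatrix}0&1\\1&0\end{pmatrix},\quad \sigma^3=\begin{pmatrix}0&i\\-i&0\end{pmatrix},$$ Clifford multiplication is given by the matrices $e^0=\begin{pmatrix}0&-\sigma^0\\-\sigma^0&0\end{pmatrix}$ and $e^j=\begin{pmatrix}0&\sigma^j\\-\sigma^j&0\end{pmatrix}$ for $j=1,2,3$. The Dirac operator is $\mathscr D\Psi=\sum_\alpha e^\alpha\cdot\nabla_{e_\alpha}\Psi$, where $$\nabla_X\Psi=X(\Psi)-\tfrac12\sum_{\beta<\gamma}\omega_{\beta\gamma}(X)\,e^\beta\cdot e^\gamma\cdot\Psi,\qquad \omega_{\beta\gamma}(X)=g(\nabla_Xe_\gamma,e_\beta),$$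 with the Levi-Civita connection of $g$ on the right. Let $\lambda,\omega\in\mathbb R$, $k\in\mathbb Z$, and let $\Psi$ be a nontrivial solution on $r_-<r<r_+$ of $$\big(\mathscr D+ie^\alpha A(e_\alpha)+i\lambda\big)\Psi=0$$ of the form $\Psi=S_+^{-1}\Phi$, where, for some complex-valued functions $X_\pm$ of $r$ and $Y_\pm$ of $\theta$, $$\Phi=e^{-i(\omega t+(k+\frac12)\varphi)}\begin{pmatrix}X_-(r)Y_-(\theta)\\X_+(r)Y_+(\theta)\\X_+(r)Y_-(\theta)\\X_-(r)Y_+(\theta)\end{pmatrix}$$ and $$S_+=\Delta_+(r)^{\frac14}\,\mathrm{diag}\big((r+ia\cos\theta)^{\frac12},(r+ia\cos\theta)^{\frac12},(r-ia\cos\theta)^{\frac12},(r-ia\cos\theta)^{\frac12}\big).$$ Let $M_{(r_-,r_+)}$ be the part $r_-<r<r_+$ of a slice $\{t=\text{constant}\}$, with the volume of the induced metric, and let $|\Psi|$ be the Hermitian norm of $\mathbb C^4$. If $\Psi\in L^p(M_{(r_-,r_+)})$ for some $p\in[1,+\infty)$, then $$\omega\,(r_-^2+a^2)+\big(k+\tfrac12\big)E_+a+r_-Q=0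 .$$ -/

import Mathlib

open scoped Matrix

noncomputable section

/-- Parameters of a Kerr-Newman-de Sitter spacetime: `κ` (the cosmological constant is `3κ²`),
rotation `a`, mass `m`, electric charge `Q` and magnetic charge `P`. -/
structure KNdS where
  κ : ℝ
  a : ℝ
  m : ℝ
  Q : ℝ
  P : ℝ
  κ_pos : 0 < κ
  m_pos : 0 < m

namespace KNdS

variable (M : KNdS)

/-! Boyer-Lindquist coordinates are `x = (t, r, θ, φ) : Fin 4 → ℝ`. -/

/-- The constant `E₊ = 1 + κ² a²`. -/
def E : ℝ := 1 + M.κ ^ 2 * M.a ^ 2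

/-- `U = r² + a² cos² θ`. -/
def U (r θ : ℝ) : ℝ := r ^ 2 + M.a ^ 2 * Real.cos θ ^ 2

/-- The horizon function `Δ₊(r) = (r² + a²)(1 - κ² r²) - 2 m r + Q² + P²`. -/
def Δr (r : ℝ) : ℝ :=
  (r ^ 2 + M.a ^ 2) * (1 - M.κ ^ 2 * r ^ 2) - 2 * M.m * r + M.Q ^ 2 + M.P ^ 2

/-- `Δ₊(θ) = 1 + κ² a² cos² θ`. -/
def Δθ (θ : ℝ) : ℝ := 1 + M.κ ^ 2 * M.a ^ 2 * Real.cos θ ^ 2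

open Polynomial in
/-- `Δ₊` as a real polynomial in `r`. -/
def ΔrPoly : ℝ[X] :=
  (X ^ 2 + C (M.a ^ 2)) * (1 - C (M.κ ^ 2) * X ^ 2) - C (2 * M.m) * X + C (M.Q ^ 2)
    + C (M.P ^ 2)

theorem eval_ΔrPoly (r : ℝ) : M.ΔrPoly.eval r = M.Δr r := by
  simp [ΔrPoly, Δr]

/-- The spacetime is extreme with event horizon `rm` and cosmological horizon `rp`:
`0 < rm < rp`, and the real roots of `Δ₊`, with multiplicity, are the double root `rm`, the simple
root `rp` and the negative root `-(2 rm + rp)`. -/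
def IsExtreme (rm rp : ℝ) : Prop :=
  0 < rm ∧ rm < rp ∧ M.ΔrPoly.roots = {rm, rm, rp, -(2 * rm + rp)}

/-- The orthonormal frame `e₀, e₁, e₂, e₃` (coordinate components of each vector field), on the
region where `Δ₊(r) > 0`. -/
def frame (α : Fin 4) (x : Fin 4 → ℝ) : Fin 4 → ℝ :=
  let r := x 1
  let θ := x 2
  ![ ![(r ^ 2 + M.a ^ 2) / √(M.U r θ * M.Δr r), 0, 0, M.a * M.E / √(M.U r θ * M.Δr r)],
     ![0, √(M.Δr r / M.U r θ), 0, 0],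
     ![0, 0, √(M.Δθ θ / M.U r θ), 0],
     ![-(M.a * Real.sin θ) / √(M.U r θ * M.Δθ θ), 0, 0,
        -(M.E / Real.sin θ) / √(M.U r θ * M.Δθ θ)] ] α

/-- The dual coframe `e⁰, e¹, e², e³` (coordinate components of each 1-form). -/
def coframe (α : Fin 4) (x : Fin 4 → ℝ) : Fin 4 → ℝ :=
  let r := x 1
  let θ := x 2
  ![ ![√(M.Δr r / M.U r θ), 0, 0, -(√(M.Δr r / M.U r θ) * (M.a * Real.sin θ ^ 2 / M.E))],
     ![0, √(M.U r θ / M.Δr r), 0, 0],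
     ![0, 0, √(M.U r θ / M.Δθ θ), 0],
     ![√(M.Δθ θ / M.U r θ) * Real.sin θ * M.a, 0, 0,
        -(√(M.Δθ θ / M.U r θ) * Real.sin θ * ((r ^ 2 + M.a ^ 2) / M.E))] ] α

/-- The Lorentzian signs `(-1, 1, 1, 1)`. -/
def η : Fin 4 → ℝ := ![-1, 1, 1, 1]

/-- The Kerr-Newman-de Sitter metric `g = -e⁰⊗e⁰ + e¹⊗e¹ + e²⊗e² + e³⊗e³`, as the matrix of its
components in the coordinates `(t, r, θ, φ)`. -/
def metric (x : Fin 4 → ℝ) : Matrix (Fin 4) (Fin 4) ℝ :=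
  Matrix.of fun i j => ∑ α, η α * M.coframe α x i * M.coframe α x j

/-- `g([e_b, e_c], e_d)` at `x`. -/
def bracketCoeff (b c d : Fin 4) (x : Fin 4 → ℝ) : ℝ :=
  VectorField.lieBracket ℝ (M.frame b) (M.frame c) x ⬝ᵥ (M.metric x *ᵥ M.frame d x)

/-- The Levi-Civita connection forms `ω_{bc}(e_α) = g(∇_{e_α} e_c, e_b)` of the orthonormal frame,
given by the Koszul formula
`2 g(∇_X Y, Z) = g([X, Y], Z) - g([X, Z], Y) - g([Y, Z], X)` for `X, Y, Z` in the frame. -/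
def connForm (b c α : Fin 4) (x : Fin 4 → ℝ) : ℝ :=
  (M.bracketCoeff α c b x - M.bracketCoeff α b c x - M.bracketCoeff c b α x) / 2

/-- The electromagnetic 1-form
`A = -(Q r / U)(dt - a sin²θ / E₊ dφ) - (P cos θ / U)(a dt - (r² + a²) / E₊ dφ)`. -/
def potential (x : Fin 4 → ℝ) : Fin 4 → ℝ :=
  let r := x 1
  let θ := x 2
  ![-(M.Q * r / M.U r θ) - M.P * Real.cos θ / M.U r θ * M.a, 0, 0,
    M.Q * r / M.U r θ * (M.a * Real.sin θ ^ 2 / M.E)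
      + M.P * Real.cos θ / M.U r θ * ((r ^ 2 + M.a ^ 2) / M.E)]

open Complex in
/-- The Clifford representation: `γ α` is Clifford multiplication by `e^α`. It satisfies
`v · w + w · v = -2 g(v, w)`. -/
def γ (α : Fin 4) : Matrix (Fin 4) (Fin 4) ℂ :=
  ![ !![0, 0, -1, 0; 0, 0, 0, -1; -1, 0, 0, 0; 0, -1, 0, 0],
     !![0, 0, -1, 0; 0, 0, 0, 1; 1, 0, 0, 0; 0, -1, 0, 0],
     !![0, 0, 0, 1; 0, 0, 1, 0; 0, -1, 0, 0; -1, 0, 0, 0],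
     !![0, 0, 0, I; 0, 0, -I, 0; 0, -I, 0, 0; I, 0, 0, 0] ] α

/-- The spinorial covariant derivative
`∇_{e_α} Ψ = e_α(Ψ) - (1/2) ∑_{b < c} ω_{bc}(e_α) e^b · e^c · Ψ`. Spinors are written in the
trivialization of the spinor bundle that lifts the frame `e₀, …, e₃`. -/
def spinorCovDeriv (α : Fin 4) (Ψ : (Fin 4 → ℝ) → Fin 4 → ℂ) (x : Fin 4 → ℝ) : Fin 4 → ℂ :=
  fderiv ℝ Ψ x (M.frame α x)
    - (1 / 2 : ℂ) • ∑ b, ∑ c ∈ Finset.Ioi b, (M.connForm b c α x : ℂ) • ((γ b * γ c) *ᵥ Ψ x)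

/-- The Dirac operator `∑_α e^α · ∇_{e_α}`. -/
def diracOp (Ψ : (Fin 4 → ℝ) → Fin 4 → ℂ) (x : Fin 4 → ℝ) : Fin 4 → ℂ :=
  ∑ α, γ α *ᵥ M.spinorCovDeriv α Ψ x

/-- The region `rm < r < rp` of spacetime, in the Boyer-Lindquist chart (with the polar angles
`0 < θ < π`, `0 < φ < 2π` on the sphere). -/
def exterior (rm rp : ℝ) : Set (Fin 4 → ℝ) :=
  {x | x 1 ∈ Set.Ioo rm rp ∧ x 2 ∈ Set.Ioo 0 Real.pi ∧ x 3 ∈ Set.Ioo 0 (2 * Real.pi)}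

/-- `Ψ` is a (classical) solution on `rm < r < rp` of the Dirac equation
`(𝒟 + i e^α A(e_α) + i lam) Ψ = 0`. -/
def IsDiracSolution (lam rm rp : ℝ) (Ψ : (Fin 4 → ℝ) → Fin 4 → ℂ) : Prop :=
  ∀ x ∈ exterior rm rp, DifferentiableAt ℝ Ψ x ∧
    M.diracOp Ψ x
      + Complex.I • ∑ α, ((M.potential x ⬝ᵥ M.frame α x : ℝ) : ℂ) • (γ α *ᵥ Ψ x)
      + (Complex.I * lam) • Ψ x = 0

open Complex in
/-- The diagonal matrix `S₊`, with principal complex square roots. -/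
def S (x : Fin 4 → ℝ) : Matrix (Fin 4) (Fin 4) ℂ :=
  let u : ℂ := ((x 1 : ℂ) + I * M.a * (Real.cos (x 2) : ℂ)) ^ (1 / 2 : ℂ)
  let v : ℂ := ((x 1 : ℂ) - I * M.a * (Real.cos (x 2) : ℂ)) ^ (1 / 2 : ℂ)
  ((M.Δr (x 1) ^ (1 / 4 : ℝ) : ℝ) : ℂ) • Matrix.diagonal ![u, u, v, v]

open Complex in
/-- The separated time-periodic spinor `Φ`. -/
def Φ (ω : ℝ) (k : ℤ) (Xp Xm Yp Ym : ℝ → ℂ) (x : Fin 4 → ℝ) : Fin 4 → ℂ :=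
  exp (-I * (ω * x 0 + ((k : ℂ) + 1 / 2) * x 3)) •
    ![Xm (x 1) * Ym (x 2), Xp (x 1) * Yp (x 2), Xp (x 1) * Ym (x 2), Xm (x 1) * Yp (x 2)]

/-- The point of the slice `t = const` with spatial coordinates `(r, θ, φ)`. -/
def slicePoint (t : ℝ) (y : ℝ × ℝ × ℝ) : Fin 4 → ℝ := ![t, y.1, y.2.1, y.2.2]

/-- The Riemannian volume `√(det h) dr dθ dφ` of the metric `h` that `g` induces on the part
`rm < r < rp` of the slice `t = const`; the indices of `h` are those of `r, θ, φ`. -/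
def sliceVolume (rm rp t : ℝ) : MeasureTheory.Measure (ℝ × ℝ × ℝ) :=
  (MeasureTheory.volume.restrict
      (Set.Ioo rm rp ×ˢ Set.Ioo 0 Real.pi ×ˢ Set.Ioo 0 (2 * Real.pi))).withDensity fun y =>
    ENNReal.ofReal √((M.metric (slicePoint t y)).submatrix Fin.succ Fin.succ).det

/-- `Ψ ∈ L^p` of the part `rm < r < rp` of the slice `t = const`, with `|Ψ|` the Hermitian norm
of `ℂ⁴` and the induced Riemannian volume. -/
def MemLpSlice (p rm rp t : ℝ) (Ψ : (Fin 4 → ℝ) → Fin 4 → ℂ) : Prop :=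
  MeasureTheory.MemLp
    (fun y => (WithLp.toLp 2 (Ψ (slicePoint t y)) : EuclideanSpace ℂ (Fin 4)))
    (ENNReal.ofReal p) (M.sliceVolume rm rp t)

end KNdS

end

/-! Write K(r) = ω(r² + a²) + (k + 1/2)E₊a + rQ and suppose that K does not vanish at the double
root r₋. The factor S₊⁻¹ absorbs the radial part of the spin connection. At one angle where Ψ does
not vanish, the Dirac equation then leaves a 2×2 system in r (`radial_ode`): with p = √Δ₊(r), X₊' =
iK/p² X₊ + β₁/p X₋ and X₋' = -iK/p² X₋ + β₂/p X₊, where β₁ = μ + iλr and β₂ = μ - iλr for a complex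
constant μ.

Put N = |X₊|² + |X₋|² and W = X₋ · conj X₊. The K terms drop out of N' = 2 Re((β₁ + conj β₂) W / p),
but 1/p behaves like 1/(r - r₋), which is not integrable, so Gronwall applied to N says nothing at
the horizon. However W rotates at the much faster rate 2K/p², and an integration by parts exploits
this: with G = p(β₁ + conj β₂)/(iK), the derivative of N + Re(GW) is only O(N). As G vanishes at r₋,
this corrected energy is comparable with N, and Gronwall keeps N above a positive constant
(`radial_lower_bound`).

Since S₊ is bounded near r₋, |Ψ| is bounded below on a box r₋ < r < r₋ + δ, θ₁ < θ < θ₂. The volume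
density there is at least c/(r - r₋), because Δ₊ has a double root, so the box has infinite volume
(`exists_sliceVolume_eq_top`). By Chebyshev's inequality Ψ lies in no L^p with p finite. -/

noncomputable section

namespace KNdS

variable (M : KNdS)

/-! ### Derivatives of the frame, through logarithmic derivatives. -/

/-- `f` has the logarithmic partial derivatives `α` and `β` in the coordinates `r` and `θ`, and does
not depend on `t` and `φ` to first order. -/
def HasLogDeriv (f : (Fin 4 → ℝ) → ℝ) (α β : ℝ) (x : Fin 4 → ℝ) : Prop :=
  HasFDerivAt f (f x • (α • ContinuousLinearMap.proj (R := ℝ) (φ := fun _ : Fin 4 => ℝ) 1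
    + β • ContinuousLinearMap.proj (R := ℝ) (φ := fun _ : Fin 4 => ℝ) 2)) x

namespace HasLogDeriv

variable {f g : (Fin 4 → ℝ) → ℝ} {α β α' β' : ℝ} {x : Fin 4 → ℝ}

theorem mul (hf : HasLogDeriv f α β x) (hg : HasLogDeriv g α' β' x) :
    HasLogDeriv (fun y => f y * g y) (α + α') (β + β') x := by
  refine (HasFDerivAt.mul hf hg).congr_fderiv ?_
  ext v
  simp
  ring

theorem inv (hf : HasLogDeriv f α β x) (h0 : f x ≠ 0) :
    HasLogDeriv (fun y => (f y)⁻¹) (-α) (-β) x := by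
  refine ((hasDerivAt_inv h0).comp_hasFDerivAt x hf).congr_fderiv ?_
  ext v
  simp
  field_simp

theorem sqrt (hf : HasLogDeriv f α β x) (h0 : 0 < f x) :
    HasLogDeriv (fun y => √(f y)) (α / 2) (β / 2) x := by
  refine (HasFDerivAt.sqrt hf h0.ne').congr_fderiv ?_
  ext v
  have h1 : √(f x) ≠ 0 := (Real.sqrt_pos.2 h0).ne'
  have h2 : f x = √(f x) * √(f x) := (Real.mul_self_sqrt h0.le).symm
  simp
  field_simp
  rw [Real.sq_sqrt h0.le]

theorem const_mul (hf : HasLogDeriv f α β x) (c : ℝ) :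
    HasLogDeriv (fun y => c * f y) α β x := by
  refine (HasFDerivAt.const_mul hf c).congr_fderiv ?_
  ext v
  simp
  ring

theorem fderiv_apply (hf : HasLogDeriv f α β x) (v : Fin 4 → ℝ) :
    fderiv ℝ f x v = f x * (α * v 1 + β * v 2) := by
  rw [HasFDerivAt.fderiv hf]
  simp [mul_add]

end HasLogDeriv

theorem Δθ_pos (θ : ℝ) : 0 < M.Δθ θ := by
  unfold Δθ; positivity

theorem E_pos : 0 < M.E := by
  unfold E; positivity

theorem U_nonneg (r θ : ℝ) : 0 ≤ M.U r θ := by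
  unfold U; positivity

theorem U_pos {r : ℝ} (hr : 0 < r) (θ : ℝ) : 0 < M.U r θ := by
  unfold U; positivity

theorem differentiable_Δr : Differentiable ℝ M.Δr := by
  unfold Δr; fun_prop

theorem hasLogDeriv_U {x : Fin 4 → ℝ} (h : 0 < M.U (x 1) (x 2)) :
    HasLogDeriv (fun y => M.U (y 1) (y 2)) (2 * x 1 / M.U (x 1) (x 2))
      (-(2 * M.a ^ 2 * Real.cos (x 2) * Real.sin (x 2)) / M.U (x 1) (x 2)) x := by
  have h1 := hasFDerivAt_apply (𝕜 := ℝ) (F' := fun _ : Fin 4 => ℝ) 1 x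
  have h2 := hasFDerivAt_apply (𝕜 := ℝ) (F' := fun _ : Fin 4 => ℝ) 2 x
  refine ((h1.pow 2).add ((h2.cos.pow 2).const_mul (M.a ^ 2))).congr_fderiv ?_
  ext v
  simp
  field_simp

theorem hasLogDeriv_Δr {x : Fin 4 → ℝ} (h : 0 < M.Δr (x 1)) :
    HasLogDeriv (fun y => M.Δr (y 1)) (deriv M.Δr (x 1) / M.Δr (x 1)) 0 x := by
  have h1 := hasFDerivAt_apply (𝕜 := ℝ) (F' := fun _ : Fin 4 => ℝ) 1 x
  refine ((M.differentiable_Δr (x 1)).hasDerivAt.comp_hasFDerivAt x h1).congr_fderiv ?_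
  ext v
  simp
  field_simp

theorem hasLogDeriv_Δθ (x : Fin 4 → ℝ) :
    HasLogDeriv (fun y => M.Δθ (y 2)) 0
      (-(2 * M.κ ^ 2 * M.a ^ 2 * Real.cos (x 2) * Real.sin (x 2)) / M.Δθ (x 2)) x := by
  have h := M.Δθ_pos (x 2)
  have h2 := hasFDerivAt_apply (𝕜 := ℝ) (F' := fun _ : Fin 4 => ℝ) 2 x
  refine (((h2.cos.pow 2).const_mul (M.κ ^ 2 * M.a ^ 2)).const_add 1).congr_fderiv ?_
  ext v
  simp
  field_simp

theorem hasLogDeriv_sin {x : Fin 4 → ℝ} (h : Real.sin (x 2) ≠ 0) :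
    HasLogDeriv (fun y => Real.sin (y 2)) 0 (Real.cos (x 2) / Real.sin (x 2)) x := by
  have h2 := hasFDerivAt_apply (𝕜 := ℝ) (F' := fun _ : Fin 4 => ℝ) 2 x
  refine h2.sin.congr_fderiv ?_
  ext v
  simp
  field_simp

theorem hasLogDeriv_sq_add_sq {x : Fin 4 → ℝ} (h : 0 < x 1) :
    HasLogDeriv (fun y => y 1 ^ 2 + M.a ^ 2) (2 * x 1 / (x 1 ^ 2 + M.a ^ 2)) 0 x := by
  have h1 := hasFDerivAt_apply (𝕜 := ℝ) (F' := fun _ : Fin 4 => ℝ) 1 x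
  have h0 : x 1 ^ 2 + M.a ^ 2 ≠ 0 := by positivity
  refine ((h1.pow 2).add_const (M.a ^ 2)).congr_fderiv ?_
  ext v
  simp
  field_simp

/-! ### Lie brackets of the frame fields. -/

theorem lieBracket_apply {V W : (Fin 4 → ℝ) → Fin 4 → ℝ} {x : Fin 4 → ℝ}
    (hV : ∀ i, DifferentiableAt ℝ (fun y => V y i) x)
    (hW : ∀ i, DifferentiableAt ℝ (fun y => W y i) x) (i : Fin 4) :
    VectorField.lieBracket ℝ V W x i
      = fderiv ℝ (fun y => W y i) x (V x) - fderiv ℝ (fun y => V y i) x (W x) := by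
  have h1 := fderiv_apply (𝕜 := ℝ) (differentiableAt_pi.2 hV) i
  have h2 := fderiv_apply (𝕜 := ℝ) (differentiableAt_pi.2 hW) i
  rw [h1, h2]
  simp [VectorField.lieBracket]

/-- The points of the chart at which the frame is smooth. -/
def chart : Set (Fin 4 → ℝ) :=
  {x | 0 < x 1 ∧ 0 < M.Δr (x 1) ∧ 0 < Real.sin (x 2)}

/-- The logarithmic partial derivatives of the components of the frame. -/
def frameLogDeriv (α i : Fin 4) (x : Fin 4 → ℝ) : ℝ × ℝ :=
  let r := x 1
  let θ := x 2
  let s := Real.sin θ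
  let c := Real.cos θ
  let U := M.U r θ
  let k := -(M.a ^ 2 * c * s)
  ![ ![(2 * r / (r ^ 2 + M.a ^ 2) - r / U - deriv M.Δr r / M.Δr r / 2, -(k / U)), 0, 0,
        (- r / U - deriv M.Δr r / M.Δr r / 2, -(k / U))],
     ![0, (deriv M.Δr r / M.Δr r / 2 - r / U, -(k / U)), 0, 0],
     ![0, 0, (-(r / U), M.κ ^ 2 * k / M.Δθ θ -(k / U)), 0],
     ![(-(r / U), c / s - M.κ ^ 2 * k / M.Δθ θ -(k / U)), 0, 0,
       (-(r / U), - (c / s) - M.κ ^ 2 * k / M.Δθ θ -(k / U))] ] α i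

/-- Every nonzero entry of the frame is a product of powers of U, Δ₊(r), Δ₊(θ), sin θ and r² + a²,
so its logarithmic derivatives are sums, with no square root left. -/
theorem hasLogDeriv_frame {x : Fin 4 → ℝ} (hx : x ∈ M.chart) (α i : Fin 4) :
    HasLogDeriv (fun y => M.frame α y i) (M.frameLogDeriv α i x).1 (M.frameLogDeriv α i x).2 x := by
  obtain ⟨h1, hΔ, hs⟩ := hx
  have hU := M.U_pos h1 (x 2)
  have hθ := M.Δθ_pos (x 2)
  have lU := (M.hasLogDeriv_U hU).sqrt hU
  have lr := (M.hasLogDeriv_Δr hΔ).sqrt hΔ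
  have lθ := (M.hasLogDeriv_Δθ x).sqrt hθ
  have ls := hasLogDeriv_sin hs.ne'
  have la := M.hasLogDeriv_sq_add_sq h1
  have sU := Real.sqrt_pos.2 hU
  have sr := Real.sqrt_pos.2 hΔ
  have sθ := Real.sqrt_pos.2 hθ
  have l0 : ∀ α β, HasLogDeriv (fun _ => 0) α β x := by
    intro α β
    simpa [HasLogDeriv] using hasFDerivAt_const (𝕜 := ℝ) (0 : ℝ) x
  have key : ∀ {f g : (Fin 4 → ℝ) → ℝ} {α β α' β' : ℝ}, HasLogDeriv f α β x → f = g → α = α' →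
      β = β' → HasLogDeriv g α' β' x := by
    rintro _ _ _ _ _ _ h rfl rfl rfl
    exact h
  have e0 := (lU.mul lr).inv (mul_pos sU sr).ne'
  have e3 := (lU.mul lθ).inv (mul_pos sU sθ).ne'
  have hsqrt : ∀ y : Fin 4 → ℝ, ∀ z, √(M.U (y 1) (y 2) * z) = √(M.U (y 1) (y 2)) * √z :=
    fun y z => Real.sqrt_mul (M.U_nonneg _ _) z
  have hsqrt' : ∀ y : Fin 4 → ℝ, ∀ z, √(z / M.U (y 1) (y 2)) = √z * (√(M.U (y 1) (y 2)))⁻¹ :=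
    fun y z => by rw [Real.sqrt_div' _ (M.U_nonneg _ _), div_eq_mul_inv]
  fin_cases α <;> fin_cases i <;> (try exact l0 _ _)
  · exact key (la.mul e0) (by funext y; simp [frame, hsqrt, div_eq_mul_inv])
      (by simp [frameLogDeriv]; ring) (by simp [frameLogDeriv]; ring)
  · exact key (e0.const_mul (M.a * M.E)) (by funext y; simp [frame, hsqrt, div_eq_mul_inv])
      (by simp [frameLogDeriv]; ring) (by simp [frameLogDeriv]; ring)
  · exact key (lr.mul (lU.inv sU.ne')) (by funext y; simp [frame, hsqrt'])
      (by simp [frameLogDeriv]; ring) (by simp [frameLogDeriv]; ring)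
  · exact key (lθ.mul (lU.inv sU.ne')) (by funext y; simp [frame, hsqrt'])
      (by simp [frameLogDeriv]; ring) (by simp [frameLogDeriv]; ring)
  · exact key ((ls.mul e3).const_mul (-M.a))
      (by funext y; simp [frame, hsqrt, div_eq_mul_inv]; ring)
      (by simp [frameLogDeriv]; ring) (by simp [frameLogDeriv]; ring)
  · exact key (((ls.inv hs.ne').mul e3).const_mul (-M.E))
      (by funext y; simp [frame, hsqrt, div_eq_mul_inv]; ring)
      (by simp [frameLogDeriv]; ring) (by simp [frameLogDeriv]; ring)

theorem lieBracket_frame_apply {x : Fin 4 → ℝ} (hx : x ∈ M.chart) (b c i : Fin 4) :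
    VectorField.lieBracket ℝ (M.frame b) (M.frame c) x i
      = M.frame c x i * ((M.frameLogDeriv c i x).1 * M.frame b x 1
          + (M.frameLogDeriv c i x).2 * M.frame b x 2)
        - M.frame b x i * ((M.frameLogDeriv b i x).1 * M.frame c x 1
          + (M.frameLogDeriv b i x).2 * M.frame c x 2) := by
  rw [lieBracket_apply (fun i => (M.hasLogDeriv_frame hx b i).differentiableAt)
    (fun i => (M.hasLogDeriv_frame hx c i).differentiableAt),
    (M.hasLogDeriv_frame hx c i).fderiv_apply, (M.hasLogDeriv_frame hx b i).fderiv_apply]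

theorem coframe_dotProduct_frame {x : Fin 4 → ℝ} (hx : x ∈ M.chart) (α β : Fin 4) :
    M.coframe α x ⬝ᵥ M.frame β x = if α = β then 1 else 0 := by
  obtain ⟨h1, hΔ, hs⟩ := hx
  have hU := M.U_pos h1 (x 2)
  have hθ := M.Δθ_pos (x 2)
  have sU := Real.sqrt_pos.2 hU
  have sr := Real.sqrt_pos.2 hΔ
  have sθ := Real.sqrt_pos.2 hθ
  have hE := M.E_pos
  have hUu : √(M.U (x 1) (x 2)) ^ 2 = x 1 ^ 2 + M.a ^ 2 - M.a ^ 2 * Real.sin (x 2) ^ 2 := by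
    rw [Real.sq_sqrt hU.le, U, Real.cos_sq']; ring
  fin_cases α <;> fin_cases β <;>
    simp [coframe, frame, dotProduct, Fin.sum_univ_four, Real.sqrt_mul hU.le,
      Real.sqrt_div' _ hU.le, Real.sqrt_div' _ hΔ.le, Real.sqrt_div' _ hθ.le] <;>
    field_simp <;> try rw [hUu]
  all_goals try ring

/-- Lowering the index of `e_d` gives ± the coframe element, so the metric need not be expanded. -/
theorem bracketCoeff_eq {x : Fin 4 → ℝ} (hx : x ∈ M.chart) (b c d : Fin 4) :
    M.bracketCoeff b c d x
      = η d * (M.coframe d x ⬝ᵥ VectorField.lieBracket ℝ (M.frame b) (M.frame c) x) := by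
  have h : M.metric x *ᵥ M.frame d x = η d • M.coframe d x := by
    ext i
    have : ∀ α, ∑ j, η α * M.coframe α x i * M.coframe α x j * M.frame d x j
        = η α * M.coframe α x i * if α = d then 1 else 0 := by
      intro α
      rw [← M.coframe_dotProduct_frame hx α d, dotProduct, Finset.mul_sum]
      exact Finset.sum_congr rfl fun j _ => by ring
    simp only [Matrix.mulVec, metric, Matrix.of_apply, dotProduct, Finset.sum_mul]
    rw [Finset.sum_comm]
    simp [this]
  rw [bracketCoeff, h, dotProduct_smul, dotProduct_comm, smul_eq_mul]

/-! ### The spin connection and the brackets that determine it. -/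

/-- A bracket table `(b, c, d) ↦ g([e_b, e_c], e_d)` with the vanishing pattern of the
Kerr-Newman-de Sitter frame. -/
def bracketTable (A B D F G H J K : ℝ) (b c d : Fin 4) : ℝ :=
  ![ ![ 0, ![-A, 0, 0, -B], ![-F, 0, 0, 0], 0 ],
     ![ ![A, 0, 0, B], 0, ![0, J, K, 0], ![0, 0, 0, D] ],
     ![ ![F, 0, 0, 0], ![0, -J, -K, 0], 0, ![G, 0, 0, H] ],
     ![ 0, ![0, 0, 0, -D], ![-G, 0, 0, -H], 0] ] b c d

theorem sum_sum_Ioi_fin_four (f : Fin 4 → Fin 4 → Fin 4 → ℂ) :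
    ∑ b, ∑ c ∈ Finset.Ioi b, f b c
      = f 0 1 + f 0 2 + f 0 3 + f 1 2 + f 1 3 + f 2 3 := by
  have h0 : (Finset.Ioi 0 : Finset (Fin 4)) = {1, 2, 3} := by decide
  have h1 : (Finset.Ioi 1 : Finset (Fin 4)) = {2, 3} := by decide
  have h2 : (Finset.Ioi 2 : Finset (Fin 4)) = {3} := by decide
  have h3 : (Finset.Ioi 3 : Finset (Fin 4)) = ∅ := by decide
  rw [Fin.sum_univ_four, h0, h1, h2, h3]
  simp [add_assoc]

open Complex in
theorem γ_0_mulVec (v : Fin 4 → ℂ) : γ 0 *ᵥ v = ![-v 2, -v 3, -v 0, -v 1] := by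
  ext i; fin_cases i <;> simp [γ, Matrix.mulVec, dotProduct, Fin.sum_univ_four]

open Complex in
theorem γ_1_mulVec (v : Fin 4 → ℂ) : γ 1 *ᵥ v = ![-v 2, v 3, v 0, -v 1] := by
  ext i; fin_cases i <;> simp [γ, Matrix.mulVec, dotProduct, Fin.sum_univ_four]

open Complex in
theorem γ_2_mulVec (v : Fin 4 → ℂ) : γ 2 *ᵥ v = ![v 3, v 2, -v 1, -v 0] := by
  ext i; fin_cases i <;> simp [γ, Matrix.mulVec, dotProduct, Fin.sum_univ_four]

open Complex in
theorem γ_3_mulVec (v : Fin 4 → ℂ) : γ 3 *ᵥ v = ![I * v 3, -I * v 2, -I * v 1, I * v 0] := by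
  ext i; fin_cases i <;> simp [γ, Matrix.mulVec, dotProduct, Fin.sum_univ_four]

-- After Clifford contraction the connection survives only through its traces (A - K - D and F + J -
-- H) and its totally antisymmetric part (G and B). The two chiralities see conjugate coefficients.
open Complex in
theorem sum_γ_mulVec_spinConnection {A B D F G H J K : ℝ} {ω : Fin 4 → Fin 4 → Fin 4 → ℝ}
    (hω : ∀ b c α, ω b c α = (bracketTable A B D F G H J K α c b
      - bracketTable A B D F G H J K α b c - bracketTable A B D F G H J K c b α) / 2)
    (ψ : Fin 4 → ℂ) :
    ∑ α, γ α *ᵥ ((1 / 2 : ℂ) • ∑ b, ∑ c ∈ Finset.Ioi b, (ω b c α : ℂ) • ((γ b * γ c) *ᵥ ψ))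
      = - ![ -((A - K - D) / 2 + I * G / 4) * ψ 2 + ((F + J - H) / 2 + I * B / 4) * ψ 3,
          ((A - K - D) / 2 + I * G / 4) * ψ 3 + ((F + J - H) / 2 + I * B / 4) * ψ 2,
          ((A - K - D) / 2 - I * G / 4) * ψ 0 - ((F + J - H) / 2 - I * B / 4) * ψ 1,
          -((A - K - D) / 2 - I * G / 4) * ψ 1 - ((F + J - H) / 2 - I * B / 4) * ψ 0] := by
  have hγ : ∀ b c, (γ b * γ c) *ᵥ ψ = γ b *ᵥ (γ c *ᵥ ψ) := fun b c => by
    rw [Matrix.mulVec_mulVec]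
  simp only [sum_sum_Ioi_fin_four, hγ]
  simp only [Fin.sum_univ_four, γ_0_mulVec, γ_1_mulVec, γ_2_mulVec, γ_3_mulVec, hω]
  ext i
  fin_cases i <;> simp [bracketTable] <;> ring_nf <;> simp only [I_sq] <;> ring

/-- The bracket table of the Kerr-Newman-de Sitter frame. -/
def frameBracketTable (x : Fin 4 → ℝ) : Fin 4 → Fin 4 → Fin 4 → ℝ :=
  let r := x 1
  let s := Real.sin (x 2)
  let co := Real.cos (x 2)
  let u := √(M.U r (x 2))
  let p := √(M.Δr r)
  let q := √(M.Δθ (x 2))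
  bracketTable
      (-(p / u) * (r / u ^ 2 - deriv M.Δr r / p ^ 2 / 2))
      (2 * r * M.a * q * s / u ^ 3)
      (-(p / u) * (r / u ^ 2))
      (-(q / u) * (M.a ^ 2 * co * s / u ^ 2))
      (2 * M.a * co * p / u ^ 3)
      (-(q / u) * (M.a ^ 2 * co * s / u ^ 2 - M.κ ^ 2 * M.a ^ 2 * co * s / q ^ 2 + co / s))
      (-(q / u) * (M.a ^ 2 * co * s / u ^ 2))
      (-(p / u) * (r / u ^ 2))

/-- The six bracket computations follow one scheme: the square roots u, p, q and sin, cos become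
atoms, and once denominators are cleared the only relation left is r² + a² = u² + a² sin² θ. The
bracket of `e₀` and `e₃` needs no relation, since both fields lie in the (t, φ) directions and
depend only on r and θ. -/
theorem bracketCoeff_0_1 {x : Fin 4 → ℝ} (hx : x ∈ M.chart) (d : Fin 4) :
    M.bracketCoeff 0 1 d x = M.frameBracketTable x 0 1 d := by
  have sU := Real.sqrt_pos.2 (M.U_pos hx.1 (x 2))
  have sr := Real.sqrt_pos.2 hx.2.1
  have sθ := Real.sqrt_pos.2 (M.Δθ_pos (x 2))
  have hs := hx.2.2
  have hr := hx.1
  have hE := M.E_pos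
  have U2 : M.U (x 1) (x 2) = √(M.U (x 1) (x 2)) ^ 2 := (Real.sq_sqrt (M.U_nonneg _ _)).symm
  have r2 : M.Δr (x 1) = √(M.Δr (x 1)) ^ 2 := (Real.sq_sqrt hx.2.1.le).symm
  have θ2 : M.Δθ (x 2) = √(M.Δθ (x 2)) ^ 2 := (Real.sq_sqrt (M.Δθ_pos _).le).symm
  have hUu : √(M.U (x 1) (x 2)) ^ 2 = x 1 ^ 2 + M.a ^ 2 * Real.cos (x 2) ^ 2 := by
    rw [← U2, U]
  have hco : Real.cos (x 2) ^ 2 = 1 - Real.sin (x 2) ^ 2 := Real.cos_sq' _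
  rw [M.bracketCoeff_eq hx, dotProduct, Fin.sum_univ_four]
  simp only [M.lieBracket_frame_apply hx]
  simp only [frameLogDeriv]
  fin_cases d <;>
    simp [η, bracketTable, frameBracketTable, coframe, frame,
      Real.sqrt_mul (M.U_nonneg _ _),
      Real.sqrt_div' _ (M.U_nonneg _ _), Real.sqrt_div' _ hx.2.1.le,
      Real.sqrt_div' _ (M.Δθ_pos (x 2)).le]
  all_goals
    generalize deriv M.Δr (x 1) = d' at *
    generalize √(M.U (x 1) (x 2)) = u at *
    generalize √(M.Δr (x 1)) = p at *
    generalize √(M.Δθ (x 2)) = q at *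
    generalize Real.sin (x 2) = s at *
    generalize Real.cos (x 2) = co at *
    generalize x 1 = r at *
    simp only [r2, U2, θ2]
    have hA : r ^ 2 + M.a ^ 2 = u ^ 2 + M.a ^ 2 * s ^ 2 := by
      linear_combination -hUu - M.a ^ 2 * hco
    have hA0 : r ^ 2 + M.a ^ 2 ≠ 0 := by positivity
    field_simp
    first | ring1 | linear_combination (-(u ^ 2 * d') - 2 * p ^ 2 * r) * hA

theorem bracketCoeff_0_2 {x : Fin 4 → ℝ} (hx : x ∈ M.chart) (d : Fin 4) :
    M.bracketCoeff 0 2 d x = M.frameBracketTable x 0 2 d := by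
  have sU := Real.sqrt_pos.2 (M.U_pos hx.1 (x 2))
  have sr := Real.sqrt_pos.2 hx.2.1
  have sθ := Real.sqrt_pos.2 (M.Δθ_pos (x 2))
  have hs := hx.2.2
  have hr := hx.1
  have hE := M.E_pos
  have U2 : M.U (x 1) (x 2) = √(M.U (x 1) (x 2)) ^ 2 := (Real.sq_sqrt (M.U_nonneg _ _)).symm
  have r2 : M.Δr (x 1) = √(M.Δr (x 1)) ^ 2 := (Real.sq_sqrt hx.2.1.le).symm
  have θ2 : M.Δθ (x 2) = √(M.Δθ (x 2)) ^ 2 := (Real.sq_sqrt (M.Δθ_pos _).le).symm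
  have hUu : √(M.U (x 1) (x 2)) ^ 2 = x 1 ^ 2 + M.a ^ 2 * Real.cos (x 2) ^ 2 := by
    rw [← U2, U]
  have hco : Real.cos (x 2) ^ 2 = 1 - Real.sin (x 2) ^ 2 := Real.cos_sq' _
  rw [M.bracketCoeff_eq hx, dotProduct, Fin.sum_univ_four]
  simp only [M.lieBracket_frame_apply hx]
  simp only [frameLogDeriv]
  fin_cases d <;>
    simp [η, bracketTable, frameBracketTable, coframe, frame,
      Real.sqrt_mul (M.U_nonneg _ _),
      Real.sqrt_div' _ (M.U_nonneg _ _), Real.sqrt_div' _ hx.2.1.le,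
      Real.sqrt_div' _ (M.Δθ_pos (x 2)).le]
  all_goals
    generalize deriv M.Δr (x 1) = d' at *
    generalize √(M.U (x 1) (x 2)) = u at *
    generalize √(M.Δr (x 1)) = p at *
    generalize √(M.Δθ (x 2)) = q at *
    generalize Real.sin (x 2) = s at *
    generalize Real.cos (x 2) = co at *
    generalize x 1 = r at *
    simp only [r2, U2, θ2]
    have hA : r ^ 2 + M.a ^ 2 = u ^ 2 + M.a ^ 2 * s ^ 2 := by
      linear_combination -hUu - M.a ^ 2 * hco
    have hA0 : r ^ 2 + M.a ^ 2 ≠ 0 := by positivity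
    field_simp
    first | ring1 | linear_combination (M.a ^ 2 * co) * hA

theorem bracketCoeff_0_3 {x : Fin 4 → ℝ} (hx : x ∈ M.chart) (d : Fin 4) :
    M.bracketCoeff 0 3 d x = M.frameBracketTable x 0 3 d := by
  have sU := Real.sqrt_pos.2 (M.U_pos hx.1 (x 2))
  have sr := Real.sqrt_pos.2 hx.2.1
  have sθ := Real.sqrt_pos.2 (M.Δθ_pos (x 2))
  have hs := hx.2.2
  have hr := hx.1
  have hE := M.E_pos
  have U2 : M.U (x 1) (x 2) = √(M.U (x 1) (x 2)) ^ 2 := (Real.sq_sqrt (M.U_nonneg _ _)).symm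
  have r2 : M.Δr (x 1) = √(M.Δr (x 1)) ^ 2 := (Real.sq_sqrt hx.2.1.le).symm
  have θ2 : M.Δθ (x 2) = √(M.Δθ (x 2)) ^ 2 := (Real.sq_sqrt (M.Δθ_pos _).le).symm
  have hUu : √(M.U (x 1) (x 2)) ^ 2 = x 1 ^ 2 + M.a ^ 2 * Real.cos (x 2) ^ 2 := by
    rw [← U2, U]
  have hco : Real.cos (x 2) ^ 2 = 1 - Real.sin (x 2) ^ 2 := Real.cos_sq' _
  rw [M.bracketCoeff_eq hx, dotProduct, Fin.sum_univ_four]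
  simp only [M.lieBracket_frame_apply hx]
  simp only [frameLogDeriv]
  fin_cases d <;>
    simp [η, bracketTable, frameBracketTable, coframe, frame,
      Real.sqrt_mul (M.U_nonneg _ _),
      Real.sqrt_div' _ (M.U_nonneg _ _), Real.sqrt_div' _ hx.2.1.le,
      Real.sqrt_div' _ (M.Δθ_pos (x 2)).le]

theorem bracketCoeff_1_2 {x : Fin 4 → ℝ} (hx : x ∈ M.chart) (d : Fin 4) :
    M.bracketCoeff 1 2 d x = M.frameBracketTable x 1 2 d := by
  have sU := Real.sqrt_pos.2 (M.U_pos hx.1 (x 2))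
  have sr := Real.sqrt_pos.2 hx.2.1
  have sθ := Real.sqrt_pos.2 (M.Δθ_pos (x 2))
  have hs := hx.2.2
  have hr := hx.1
  have hE := M.E_pos
  have U2 : M.U (x 1) (x 2) = √(M.U (x 1) (x 2)) ^ 2 := (Real.sq_sqrt (M.U_nonneg _ _)).symm
  have r2 : M.Δr (x 1) = √(M.Δr (x 1)) ^ 2 := (Real.sq_sqrt hx.2.1.le).symm
  have θ2 : M.Δθ (x 2) = √(M.Δθ (x 2)) ^ 2 := (Real.sq_sqrt (M.Δθ_pos _).le).symm
  have hUu : √(M.U (x 1) (x 2)) ^ 2 = x 1 ^ 2 + M.a ^ 2 * Real.cos (x 2) ^ 2 := by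
    rw [← U2, U]
  have hco : Real.cos (x 2) ^ 2 = 1 - Real.sin (x 2) ^ 2 := Real.cos_sq' _
  rw [M.bracketCoeff_eq hx, dotProduct, Fin.sum_univ_four]
  simp only [M.lieBracket_frame_apply hx]
  simp only [frameLogDeriv]
  fin_cases d <;>
    simp [η, bracketTable, frameBracketTable, coframe, frame,
      Real.sqrt_mul (M.U_nonneg _ _),
      Real.sqrt_div' _ (M.U_nonneg _ _), Real.sqrt_div' _ hx.2.1.le,
      Real.sqrt_div' _ (M.Δθ_pos (x 2)).le]
  all_goals
    generalize deriv M.Δr (x 1) = d' at *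
    generalize √(M.U (x 1) (x 2)) = u at *
    generalize √(M.Δr (x 1)) = p at *
    generalize √(M.Δθ (x 2)) = q at *
    generalize Real.sin (x 2) = s at *
    generalize Real.cos (x 2) = co at *
    generalize x 1 = r at *
    simp only [r2, U2, θ2]
    field_simp

theorem bracketCoeff_1_3 {x : Fin 4 → ℝ} (hx : x ∈ M.chart) (d : Fin 4) :
    M.bracketCoeff 1 3 d x = M.frameBracketTable x 1 3 d := by
  have sU := Real.sqrt_pos.2 (M.U_pos hx.1 (x 2))
  have sr := Real.sqrt_pos.2 hx.2.1
  have sθ := Real.sqrt_pos.2 (M.Δθ_pos (x 2))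
  have hs := hx.2.2
  have hr := hx.1
  have hE := M.E_pos
  have U2 : M.U (x 1) (x 2) = √(M.U (x 1) (x 2)) ^ 2 := (Real.sq_sqrt (M.U_nonneg _ _)).symm
  have r2 : M.Δr (x 1) = √(M.Δr (x 1)) ^ 2 := (Real.sq_sqrt hx.2.1.le).symm
  have θ2 : M.Δθ (x 2) = √(M.Δθ (x 2)) ^ 2 := (Real.sq_sqrt (M.Δθ_pos _).le).symm
  have hUu : √(M.U (x 1) (x 2)) ^ 2 = x 1 ^ 2 + M.a ^ 2 * Real.cos (x 2) ^ 2 := by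
    rw [← U2, U]
  have hco : Real.cos (x 2) ^ 2 = 1 - Real.sin (x 2) ^ 2 := Real.cos_sq' _
  rw [M.bracketCoeff_eq hx, dotProduct, Fin.sum_univ_four]
  simp only [M.lieBracket_frame_apply hx]
  simp only [frameLogDeriv]
  fin_cases d <;>
    simp [η, bracketTable, frameBracketTable, coframe, frame,
      Real.sqrt_mul (M.U_nonneg _ _),
      Real.sqrt_div' _ (M.U_nonneg _ _), Real.sqrt_div' _ hx.2.1.le,
      Real.sqrt_div' _ (M.Δθ_pos (x 2)).le]
  all_goals
    generalize deriv M.Δr (x 1) = d' at *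
    generalize √(M.U (x 1) (x 2)) = u at *
    generalize √(M.Δr (x 1)) = p at *
    generalize √(M.Δθ (x 2)) = q at *
    generalize Real.sin (x 2) = s at *
    generalize Real.cos (x 2) = co at *
    generalize x 1 = r at *
    simp only [r2, U2, θ2]
    have hA : r ^ 2 + M.a ^ 2 = u ^ 2 + M.a ^ 2 * s ^ 2 := by
      linear_combination -hUu - M.a ^ 2 * hco
    have hA0 : r ^ 2 + M.a ^ 2 ≠ 0 := by positivity
    field_simp
    first | ring1 | linear_combination (-1) * hA

theorem bracketCoeff_2_3 {x : Fin 4 → ℝ} (hx : x ∈ M.chart) (d : Fin 4) :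
    M.bracketCoeff 2 3 d x = M.frameBracketTable x 2 3 d := by
  have sU := Real.sqrt_pos.2 (M.U_pos hx.1 (x 2))
  have sr := Real.sqrt_pos.2 hx.2.1
  have sθ := Real.sqrt_pos.2 (M.Δθ_pos (x 2))
  have hs := hx.2.2
  have hr := hx.1
  have hE := M.E_pos
  have U2 : M.U (x 1) (x 2) = √(M.U (x 1) (x 2)) ^ 2 := (Real.sq_sqrt (M.U_nonneg _ _)).symm
  have r2 : M.Δr (x 1) = √(M.Δr (x 1)) ^ 2 := (Real.sq_sqrt hx.2.1.le).symm
  have θ2 : M.Δθ (x 2) = √(M.Δθ (x 2)) ^ 2 := (Real.sq_sqrt (M.Δθ_pos _).le).symm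
  have hUu : √(M.U (x 1) (x 2)) ^ 2 = x 1 ^ 2 + M.a ^ 2 * Real.cos (x 2) ^ 2 := by
    rw [← U2, U]
  have hco : Real.cos (x 2) ^ 2 = 1 - Real.sin (x 2) ^ 2 := Real.cos_sq' _
  rw [M.bracketCoeff_eq hx, dotProduct, Fin.sum_univ_four]
  simp only [M.lieBracket_frame_apply hx]
  simp only [frameLogDeriv]
  fin_cases d <;>
    simp [η, bracketTable, frameBracketTable, coframe, frame,
      Real.sqrt_mul (M.U_nonneg _ _),
      Real.sqrt_div' _ (M.U_nonneg _ _), Real.sqrt_div' _ hx.2.1.le,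
      Real.sqrt_div' _ (M.Δθ_pos (x 2)).le]
  all_goals
    generalize deriv M.Δr (x 1) = d' at *
    generalize √(M.U (x 1) (x 2)) = u at *
    generalize √(M.Δr (x 1)) = p at *
    generalize √(M.Δθ (x 2)) = q at *
    generalize Real.sin (x 2) = s at *
    generalize Real.cos (x 2) = co at *
    generalize x 1 = r at *
    simp only [r2, U2, θ2]
    have hA : r ^ 2 + M.a ^ 2 = u ^ 2 + M.a ^ 2 * s ^ 2 := by
      linear_combination -hUu - M.a ^ 2 * hco
    have hA0 : r ^ 2 + M.a ^ 2 ≠ 0 := by positivity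
    field_simp
    first | ring1 | linear_combination (co * s ^ 2 * M.a ^ 2 * u ^ 2 * M.κ ^ 2 + co * s ^ 2 * M.a ^ 2 * q ^ 2 - co * u ^ 2 * q ^ 2) * hA

theorem bracketCoeff_swap (b c d : Fin 4) (x : Fin 4 → ℝ) :
    M.bracketCoeff b c d x = -M.bracketCoeff c b d x := by
  rw [bracketCoeff, VectorField.lieBracket_swap, neg_dotProduct, bracketCoeff]

theorem bracketCoeff_eq_frameBracketTable {x : Fin 4 → ℝ} (hx : x ∈ M.chart) (b c d : Fin 4) :
    M.bracketCoeff b c d x = M.frameBracketTable x b c d := by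
  have hself : ∀ b, M.bracketCoeff b b d x = 0 := fun b => by
    have := M.bracketCoeff_swap b b d x
    linarith
  have hswap : ∀ b c, M.frameBracketTable x b c d = -M.frameBracketTable x c b d := by
    intro b c
    fin_cases b <;> fin_cases c <;> fin_cases d <;> simp [frameBracketTable, bracketTable]
  have hself' : ∀ b, M.frameBracketTable x b b d = 0 := fun b => by
    have := hswap b b
    linarith
  have h01 := M.bracketCoeff_0_1 hx d
  have h02 := M.bracketCoeff_0_2 hx d
  have h03 := M.bracketCoeff_0_3 hx d
  have h12 := M.bracketCoeff_1_2 hx d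
  have h13 := M.bracketCoeff_1_3 hx d
  have h23 := M.bracketCoeff_2_3 hx d
  have key : ∀ b c, M.bracketCoeff b c d x = M.frameBracketTable x b c d →
      M.bracketCoeff c b d x = M.frameBracketTable x c b d := by
    intro b c h
    rw [M.bracketCoeff_swap, hswap, h]
  fin_cases b <;> fin_cases c
  exacts [(hself 0).trans (hself' 0).symm, h01, h02, h03, key _ _ h01,
    (hself 1).trans (hself' 1).symm, h12, h13, key _ _ h02, key _ _ h12,
    (hself 2).trans (hself' 2).symm, h23, key _ _ h03, key _ _ h13, key _ _ h23,
    (hself 3).trans (hself' 3).symm]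

/-! ### Derivatives of a separated spinor. -/

open Complex

theorem hasDerivAt_comp_update {F : (Fin 4 → ℝ) → ℂ} {x : Fin 4 → ℝ} (hF : DifferentiableAt ℝ F x)
    (i : Fin 4) :
    HasDerivAt (fun s => F (Function.update x i s)) (fderiv ℝ F x (Pi.single i 1)) (x i) := by
  have h := hF.hasFDerivAt
  rw [← Function.update_eq_self i x] at h
  have h2 := h.comp_hasDerivAt (x i) (hasDerivAt_update x i (x i))
  rwa [Function.update_eq_self] at h2

/-- Here f is not assumed differentiable. The formula with `deriv f` holds anyway, as `deriv`
commutes with scalar multiplication in a field even at its default value; differentiability of f is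
recovered when c ≠ 0. -/
theorem deriv_of_mul_eq {h σ f : ℝ → ℂ} {h' l c : ℂ} {s : ℝ} (hh : HasDerivAt h h' s)
    (hσ : HasDerivAt σ (σ s * l) s) (h0 : σ s ≠ 0) (he : ∀ᶠ y in nhds s, h y * σ y = c * f y) :
    h' = c * deriv f s / σ s - l * h s ∧ (c ≠ 0 → DifferentiableAt ℝ f s) := by
  have h1 := (hh.mul hσ).congr_of_eventuallyEq (he.mono fun y hy => hy.symm)
  constructor
  · have h2 : deriv (fun y => c * f y) s = c * deriv f s := deriv_const_mul_field c
    rw [h1.deriv] at h2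
    rw [← h2]
    field_simp
    ring
  · intro hc
    have h2 := (h1.const_mul c⁻¹).differentiableAt
    refine h2.congr_of_eventuallyEq (Filter.Eventually.of_forall fun y => ?_)
    field_simp

/-- The diagonal entries of `S₊`: `ε = 1` for the first two, `ε = -1` for the others. -/
def scale (ε r θ : ℝ) : ℂ :=
  ((M.Δr r ^ (1 / 4 : ℝ) : ℝ) : ℂ) * ((r : ℂ) + ε * (I * M.a * (Real.cos θ : ℂ))) ^ (1 / 2 : ℂ)

theorem ofReal_add_ne_zero {r : ℝ} (hr : 0 < r) (ε θ : ℝ) :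
    (r : ℂ) + ε * (I * M.a * (Real.cos θ : ℂ)) ≠ 0 := by
  intro h
  have := congrArg Complex.re h
  simp at this
  exact hr.ne' this

/-- For r > 0 the argument of the root stays in the right half plane, where the principal root is
smooth. -/
theorem mem_slitPlane {r : ℝ} (hr : 0 < r) (ε θ : ℝ) :
    (r : ℂ) + ε * (I * M.a * (Real.cos θ : ℂ)) ∈ slitPlane := by
  left
  simpa using hr

theorem scale_ne_zero {r : ℝ} (hr : 0 < r) (hΔ : 0 < M.Δr r) (ε θ : ℝ) : M.scale ε r θ ≠ 0 := by
  refine mul_ne_zero (by exact_mod_cast (Real.rpow_pos_of_pos hΔ _).ne') ?_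
  rw [Complex.cpow_ne_zero_iff]
  left
  exact M.ofReal_add_ne_zero hr ε θ

theorem hasDerivAt_cpow_half {w : ℝ → ℂ} {w' : ℂ} {s : ℝ} (hw : HasDerivAt w w' s)
    (h : w s ∈ slitPlane) :
    HasDerivAt (fun y => w y ^ (1 / 2 : ℂ)) (w s ^ (1 / 2 : ℂ) * (w' / (2 * w s))) s := by
  have h0 : w s ≠ 0 := slitPlane_ne_zero h
  have h1 := (Complex.hasStrictDerivAt_cpow_const (c := (1 / 2 : ℂ)) h).hasDerivAt.scomp s hw
  refine h1.congr_deriv ?_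
  rw [Complex.cpow_sub _ _ h0]
  simp
  field_simp

theorem hasDerivAt_scale_r {r : ℝ} (hr : 0 < r) (hΔ : 0 < M.Δr r) (ε θ : ℝ) :
    HasDerivAt (fun y => M.scale ε y θ) (M.scale ε r θ * (deriv M.Δr r / (4 * M.Δr r)
      + 1 / (2 * (r + ε * (I * M.a * (Real.cos θ : ℂ)))))) r := by
  have h1 := ((M.differentiable_Δr r).hasDerivAt.rpow_const (p := 1 / 4) (Or.inl hΔ.ne')).ofReal_comp
  have h2 : HasDerivAt (fun y : ℝ => (y : ℂ) + ε * (I * M.a * (Real.cos θ : ℂ))) 1 r :=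
    Complex.ofRealCLM.hasDerivAt.add_const _
  refine (h1.mul (hasDerivAt_cpow_half h2 (M.mem_slitPlane hr ε θ))).congr_deriv ?_
  have h3 := M.ofReal_add_ne_zero hr ε θ
  rw [Real.rpow_sub_one hΔ.ne', scale]
  have h4 : (M.Δr r : ℂ) ≠ 0 := by exact_mod_cast hΔ.ne'
  push_cast
  field_simp

theorem hasDerivAt_scale_θ {r : ℝ} (hr : 0 < r) (ε θ : ℝ) :
    HasDerivAt (fun y => M.scale ε r y) (M.scale ε r θ * (-(ε * (I * M.a * (Real.sin θ : ℂ)))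
      / (2 * (r + ε * (I * M.a * (Real.cos θ : ℂ)))))) θ := by
  have h2 : HasDerivAt (fun y : ℝ => (r : ℂ) + ε * (I * M.a * (Real.cos y : ℂ)))
      (-(ε * (I * M.a * (Real.sin θ : ℂ)))) θ := by
    refine ((((Real.hasDerivAt_cos θ).ofReal_comp.const_mul (I * M.a)).const_mul
      (ε : ℂ)).const_add (r : ℂ)).congr_deriv ?_
    push_cast
    ring
  refine ((hasDerivAt_cpow_half h2 (M.mem_slitPlane hr ε θ)).const_mul
    ((M.Δr r ^ (1 / 4 : ℝ) : ℝ) : ℂ)).congr_deriv ?_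
  rw [scale]
  ring

theorem isOpen_exterior (rm rp : ℝ) : IsOpen (exterior rm rp) := by
  refine (isOpen_Ioo.preimage (continuous_apply (1 : Fin 4))).inter
    ((isOpen_Ioo.preimage (continuous_apply (2 : Fin 4))).inter
      (isOpen_Ioo.preimage (continuous_apply (3 : Fin 4))))

/-- The phase of a separated time-periodic spinor. -/
def phase (ω : ℝ) (k : ℤ) (t φ : ℝ) : ℂ := exp (-I * (ω * t + ((k : ℂ) + 1 / 2) * φ))

/-- The product identity is restricted to the coordinate lines through x. The last two conclusions
supply the regularity of the radial and angular factors, which are arbitrary functions a priori. -/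
theorem fderiv_separated {rm rp : ℝ} {x : Fin 4 → ℝ} (hx : x ∈ exterior rm rp) (hr : 0 < x 1)
    (hΔ : 0 < M.Δr (x 1)) {F : (Fin 4 → ℝ) → ℂ} (hF : DifferentiableAt ℝ F x) {ω : ℝ} {k : ℤ}
    {ε : ℝ} {f g : ℝ → ℂ}
    (h : ∀ y ∈ exterior rm rp, F y * M.scale ε (y 1) (y 2)
      = phase ω k (y 0) (y 3) * (f (y 1) * g (y 2))) :
    fderiv ℝ F x (Pi.single 0 1) = -I * ω * F x ∧
    fderiv ℝ F x (Pi.single 3 1) = -I * (k + 1 / 2) * F x ∧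
    fderiv ℝ F x (Pi.single 1 1) = phase ω k (x 0) (x 3) * g (x 2) * deriv f (x 1)
        / M.scale ε (x 1) (x 2)
      - (deriv M.Δr (x 1) / (4 * M.Δr (x 1))
        + 1 / (2 * (x 1 + ε * (I * M.a * (Real.cos (x 2) : ℂ))))) * F x ∧
    fderiv ℝ F x (Pi.single 2 1) = phase ω k (x 0) (x 3) * f (x 1) * deriv g (x 2)
        / M.scale ε (x 1) (x 2)
      - (-(ε * (I * M.a * (Real.sin (x 2) : ℂ)))
      / (2 * (x 1 + ε * (I * M.a * (Real.cos (x 2) : ℂ))))) * F x ∧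
    (g (x 2) ≠ 0 → DifferentiableAt ℝ f (x 1)) ∧ (f (x 1) ≠ 0 → DifferentiableAt ℝ g (x 2)) := by
  have h0 := M.scale_ne_zero hr hΔ ε (x 2)
  have hev : ∀ i, ∀ᶠ s in nhds (x i), Function.update x i s ∈ exterior rm rp := by
    intro i
    have hc : Continuous fun s : ℝ => Function.update x i s := continuous_const.update i continuous_id
    refine hc.continuousAt.eventually_mem ((isOpen_exterior rm rp).mem_nhds ?_)
    simpa using hx
  have hph : phase ω k (x 0) (x 3) ≠ 0 := exp_ne_zero _
  refine ⟨?_, ?_, ?_⟩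
  · have := deriv_of_mul_eq (σ := fun _ => M.scale ε (x 1) (x 2)) (l := 0)
      (f := fun t => phase ω k t (x 3)) (c := f (x 1) * g (x 2)) (hasDerivAt_comp_update hF 0)
      (by simpa using hasDerivAt_const (x 0) (M.scale ε (x 1) (x 2))) h0 ((hev 0).mono fun s hs => by
        have := h _ hs
        simpa [mul_comm] using this)
    rw [this.1]
    have hd : HasDerivAt (fun t => phase ω k t (x 3)) (phase ω k (x 0) (x 3) * (-I * ω)) (x 0) := by
      unfold phase
      refine HasDerivAt.cexp ?_
      refine (((Complex.ofRealCLM.hasDerivAt.const_mul (ω : ℂ)).add_const _).const_mul (-I)).congr_deriv ?_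
      simp
    rw [hd.deriv]
    have h1 := h x hx
    field_simp
    linear_combination I * ω * h1
  · have := deriv_of_mul_eq (σ := fun _ => M.scale ε (x 1) (x 2)) (l := 0)
      (f := fun t => phase ω k (x 0) t) (c := f (x 1) * g (x 2)) (hasDerivAt_comp_update hF 3)
      (by simpa using hasDerivAt_const (x 3) (M.scale ε (x 1) (x 2))) h0 ((hev 3).mono fun s hs => by
        have := h _ hs
        simpa [mul_comm] using this)
    rw [this.1]
    have hd : HasDerivAt (fun t => phase ω k (x 0) t)
        (phase ω k (x 0) (x 3) * (-I * (k + 1 / 2))) (x 3) := by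
      unfold phase
      refine HasDerivAt.cexp ?_
      refine (((Complex.ofRealCLM.hasDerivAt.const_mul ((k : ℂ) + 1 / 2)).const_add _).const_mul
        (-I)).congr_deriv ?_
      simp
    rw [hd.deriv]
    have h1 := h x hx
    field_simp
    linear_combination I * (2 * k + 1) * h1
  · have h1 := deriv_of_mul_eq (σ := fun r => M.scale ε r (x 2))
      (f := f) (c := phase ω k (x 0) (x 3) * g (x 2)) (hasDerivAt_comp_update hF 1)
      (M.hasDerivAt_scale_r hr hΔ ε (x 2)) h0 ((hev 1).mono fun s hs => by
        have := h _ hs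
        simp at this ⊢
        rw [this]; ring)
    have h2 := deriv_of_mul_eq (σ := fun θ => M.scale ε (x 1) θ)
      (f := g) (c := phase ω k (x 0) (x 3) * f (x 1)) (hasDerivAt_comp_update hF 2)
      (M.hasDerivAt_scale_θ hr ε (x 2)) h0 ((hev 2).mono fun s hs => by
        have := h _ hs
        simp at this ⊢
        rw [this]; ring)
    refine ⟨by simpa using h1.1, by simpa using h2.1, fun hg => h1.2 (mul_ne_zero hph hg),
      fun hf => h2.2 (mul_ne_zero hph hf)⟩

theorem S_mulVec {x : Fin 4 → ℝ} (v : Fin 4 → ℂ) :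
    M.S x *ᵥ v = ![v 0 * M.scale 1 (x 1) (x 2), v 1 * M.scale 1 (x 1) (x 2),
      v 2 * M.scale (-1) (x 1) (x 2), v 3 * M.scale (-1) (x 1) (x 2)] := by
  ext i
  fin_cases i <;> simp [S, scale, Matrix.smul_mulVec, Matrix.mulVec_diagonal, sub_eq_add_neg] <;> ring

theorem S_mulVec_inv_mulVec {x : Fin 4 → ℝ} (hr : 0 < x 1) (hΔ : 0 < M.Δr (x 1)) (v : Fin 4 → ℂ) :
    M.S x *ᵥ ((M.S x)⁻¹ *ᵥ v) = v := by
  have h1 := M.scale_ne_zero hr hΔ 1 (x 2)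
  have h2 := M.scale_ne_zero hr hΔ (-1) (x 2)
  have hdiag : M.S x = Matrix.diagonal ![M.scale 1 (x 1) (x 2), M.scale 1 (x 1) (x 2),
      M.scale (-1) (x 1) (x 2), M.scale (-1) (x 1) (x 2)] := by
    apply Matrix.ext_of_mulVec_single
    intro i
    rw [S_mulVec]
    ext j
    fin_cases i <;> fin_cases j <;> simp [Matrix.diagonal]
  have hdet : IsUnit (M.S x).det := by
    rw [hdiag, Matrix.det_diagonal, Fin.prod_univ_four, isUnit_iff_ne_zero]
    simp [h1, h2]
  rw [Matrix.mulVec_mulVec, Matrix.mul_nonsing_inv _ hdet, Matrix.one_mulVec]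

theorem components_eq {rm rp ω : ℝ} {k : ℤ} {Xp Xm Yp Ym : ℝ → ℂ} {Ψ : (Fin 4 → ℝ) → Fin 4 → ℂ}
    (hrm : 0 < rm) (hΔ : ∀ r ∈ Set.Ioo rm rp, 0 < M.Δr r)
    (hform : ∀ x ∈ exterior rm rp, Ψ x = (M.S x)⁻¹ *ᵥ Φ ω k Xp Xm Yp Ym x)
    {y : Fin 4 → ℝ} (hy : y ∈ exterior rm rp) :
    Ψ y 0 * M.scale 1 (y 1) (y 2) = phase ω k (y 0) (y 3) * (Xm (y 1) * Ym (y 2)) ∧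
    Ψ y 1 * M.scale 1 (y 1) (y 2) = phase ω k (y 0) (y 3) * (Xp (y 1) * Yp (y 2)) ∧
    Ψ y 2 * M.scale (-1) (y 1) (y 2) = phase ω k (y 0) (y 3) * (Xp (y 1) * Ym (y 2)) ∧
    Ψ y 3 * M.scale (-1) (y 1) (y 2) = phase ω k (y 0) (y 3) * (Xm (y 1) * Yp (y 2)) := by
  have h : M.S y *ᵥ Ψ y = Φ ω k Xp Xm Yp Ym y := by
    rw [hform y hy, M.S_mulVec_inv_mulVec (hrm.trans hy.1.1) (hΔ _ hy.1)]
  refine ⟨?_, ?_, ?_, ?_⟩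
  · simpa [S_mulVec, Φ, phase] using congrFun h 0
  · simpa [S_mulVec, Φ, phase] using congrFun h 1
  · simpa [S_mulVec, Φ, phase] using congrFun h 2
  · simpa [S_mulVec, Φ, phase] using congrFun h 3

/-! ### The Dirac equation in components and its separation. -/

/-- The two 1-forms in A are multiples of `e⁰` and `e³`, so `e₀` sees only the electric charge and
`e₃` only the magnetic one. -/
theorem potential_dotProduct_frame {x : Fin 4 → ℝ} (hx : x ∈ M.chart) :
    M.potential x ⬝ᵥ M.frame 0 x = -(M.Q * x 1) / (√(M.U (x 1) (x 2)) * √(M.Δr (x 1))) ∧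
    M.potential x ⬝ᵥ M.frame 1 x = 0 ∧ M.potential x ⬝ᵥ M.frame 2 x = 0 ∧
    M.potential x ⬝ᵥ M.frame 3 x = -(M.P * Real.cos (x 2))
      / (Real.sin (x 2) * √(M.U (x 1) (x 2)) * √(M.Δθ (x 2))) := by
  have sU := Real.sqrt_pos.2 (M.U_pos hx.1 (x 2))
  have sr := Real.sqrt_pos.2 hx.2.1
  have sθ := Real.sqrt_pos.2 (M.Δθ_pos (x 2))
  have hs := hx.2.2
  have hr := hx.1
  have hE := M.E_pos
  have U2 : M.U (x 1) (x 2) = √(M.U (x 1) (x 2)) ^ 2 := (Real.sq_sqrt (M.U_nonneg _ _)).symm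
  have hA : x 1 ^ 2 + M.a ^ 2 = √(M.U (x 1) (x 2)) ^ 2 + M.a ^ 2 * Real.sin (x 2) ^ 2 := by
    rw [← U2, U, Real.cos_sq']; ring
  refine ⟨?_, ?_, ?_, ?_⟩ <;>
    simp [potential, frame, dotProduct, Fin.sum_univ_four, Real.sqrt_mul (M.U_nonneg _ _)]
  all_goals
    generalize √(M.U (x 1) (x 2)) = u at *
    generalize √(M.Δr (x 1)) = p at *
    generalize √(M.Δθ (x 2)) = q at *
    generalize Real.sin (x 2) = s at *
    generalize Real.cos (x 2) = co at *
    generalize x 1 = r at *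
    simp only [U2]
    field_simp
    rw [hA]
    ring

theorem frame_decomp (x v : Fin 4 → ℝ) (F : (Fin 4 → ℝ) → Fin 4 → ℂ) (hF : DifferentiableAt ℝ F x)
    (j : Fin 4) :
    fderiv ℝ F x v j = ∑ i, (v i : ℂ) * fderiv ℝ (fun y => F y j) x (Pi.single i 1) := by
  have h1 : ∀ w, fderiv ℝ F x w j = fderiv ℝ (fun y => F y j) x w := fun w => by
    rw [fderiv_apply hF]; simp
  rw [h1]
  conv_lhs => rw [pi_eq_sum_univ' v, map_sum]
  refine Finset.sum_congr rfl fun i _ => ?_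
  rw [map_smul, real_smul]

/-- The four components of the Dirac equation in terms of the coordinate derivatives `D i j` of the
component `j` of the spinor in the direction `i`. -/
theorem dirac_components {lam rm rp : ℝ} {Ψ : (Fin 4 → ℝ) → Fin 4 → ℂ}
    (hsol : M.IsDiracSolution lam rm rp Ψ) {x : Fin 4 → ℝ} (hx : x ∈ M.chart)
    (hx' : x ∈ exterior rm rp) {r s co u p q : ℝ} (hr : r = x 1) (hs : s = Real.sin (x 2))
    (hco : co = Real.cos (x 2)) (hu : u = √(M.U (x 1) (x 2))) (hp : p = √(M.Δr (x 1)))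
    (hq : q = √(M.Δθ (x 2)))
    {D : Fin 4 → Fin 4 → ℂ} (hD : ∀ i j, D i j = fderiv ℝ (fun y => Ψ y j) x (Pi.single i 1))
    {T R Θ Φ : Fin 4 → ℂ} {z w : ℂ}
    (hT : ∀ j, T j = (r ^ 2 + M.a ^ 2) / (u * p) * D 0 j + M.a * M.E / (u * p) * D 3 j
      - I * (M.Q * r / (u * p)) * Ψ x j)
    (hR : ∀ j, R j = p / u * D 1 j)
    (hΘ : ∀ j, Θ j = q / u * D 2 j)
    (hΦ : ∀ j, Φ j = -(M.a * s) / (u * q) * D 0 j - M.E / s / (u * q) * D 3 j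
      - I * (M.P * co / (s * u * q)) * Ψ x j)
    (hz : z = p / u * (r / u ^ 2 + deriv M.Δr (x 1) / (2 * p ^ 2) + I * (M.a * co / u ^ 2)) / 2)
    (hw : w = q / u * ((-M.a ^ 2 * co * s + I * (r * M.a * s)) / u ^ 2
      - M.κ ^ 2 * M.a ^ 2 * co * s / q ^ 2 + co / s) / 2) :
    -T 2 - (R 2 + z * Ψ x 2) + (Θ 3 + w * Ψ x 3) + I * Φ 3 + I * lam * Ψ x 0 = 0 ∧
    -T 3 + (R 3 + z * Ψ x 3) + (Θ 2 + w * Ψ x 2) - I * Φ 2 + I * lam * Ψ x 1 = 0 ∧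
    -T 0 + (R 0 + star z * Ψ x 0) - (Θ 1 + star w * Ψ x 1) - I * Φ 1 + I * lam * Ψ x 2 = 0 ∧
    -T 1 - (R 1 + star z * Ψ x 1) - (Θ 0 + star w * Ψ x 0) + I * Φ 0 + I * lam * Ψ x 3 = 0 := by
  obtain ⟨hdiff, heq⟩ := hsol x hx'
  have hdec := fun v j => frame_decomp x v Ψ hdiff j
  simp only [← hD] at hdec
  have hconn : ∀ b c α, M.connForm b c α x = (M.frameBracketTable x α c b
      - M.frameBracketTable x α b c - M.frameBracketTable x c b α) / 2 := by
    intro b c α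
    simp only [connForm, M.bracketCoeff_eq_frameBracketTable hx]
  have hspin := sum_γ_mulVec_spinConnection (ω := fun b c α => M.connForm b c α x) hconn (Ψ x)
  obtain ⟨a0, a1, a2, a3⟩ := M.potential_dotProduct_frame hx
  simp only [diracOp, spinorCovDeriv, Matrix.mulVec_sub, Finset.sum_sub_distrib] at heq
  rw [hspin] at heq
  clear hspin hconn
  simp only [Fin.sum_univ_four, a0, a1, a2, a3, γ_0_mulVec, γ_1_mulVec, γ_2_mulVec,
    γ_3_mulVec] at heq
  have h0 := congrFun heq 0
  have h1 := congrFun heq 1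
  have h2 := congrFun heq 2
  have h3 := congrFun heq 3
  clear heq
  rw [← hr] at hu hp hz
  simp only [← hr] at h0 h1 h2 h3
  simp only [← hu, ← hp, ← hq, ← hs, ← hco] at h0 h1 h2 h3
  simp [hdec, Fin.sum_univ_four, frame, Real.sqrt_mul (M.U_nonneg _ _),
      Real.sqrt_div' _ (M.U_nonneg _ _), ← hu, ← hp, ← hq, ← hr, ← hs] at h0 h1 h2 h3
  have hz' : star z = p / u * (r / u ^ 2 + deriv M.Δr r / (2 * p ^ 2) - I * (M.a * co / u ^ 2)) / 2 := by
    rw [hz]; simp [sub_eq_add_neg]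
  have hw' : star w = q / u * ((-M.a ^ 2 * co * s - I * (r * M.a * s)) / u ^ 2
      - M.κ ^ 2 * M.a ^ 2 * co * s / q ^ 2 + co / s) / 2 := by
    rw [hw]; simp [sub_eq_add_neg]
  rw [hz', hw', hz, hw]
  simp only [hT, hR, hΘ, hΦ]
  exact ⟨by linear_combination h0, by linear_combination h1, by linear_combination h2,
    by linear_combination h3⟩

theorem cpow_half_mul_self (z : ℂ) : z ^ (1 / 2 : ℂ) * z ^ (1 / 2 : ℂ) = z := by
  rw [← sq, ← Complex.cpow_mul_nat]
  norm_num

/-- U = z · conj z with z = r + iεa cos θ, and the principal root commutes with conjugation off the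
negative axis. This converts the mass term, which couples opposite chiralities, to the scale of the
other terms. -/
theorem scale_mul_sqrt_U {r : ℝ} (hr : 0 < r) (ε : ℝ) (hε : ε ^ 2 = 1) (θ : ℝ) :
    M.scale ε r θ * √(M.U r θ)
      = M.scale (-ε) r θ * (r + ε * (I * M.a * (Real.cos θ : ℂ))) := by
  have hz := M.mem_slitPlane hr ε θ
  set z : ℂ := r + ε * (I * M.a * (Real.cos θ : ℂ)) with hzdef
  have hc : (r : ℂ) + (-ε : ℝ) * (I * M.a * (Real.cos θ : ℂ)) = (starRingEnd ℂ) z := by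
    simp [hzdef, -ofReal_cos]
  have h2 : (starRingEnd ℂ) z ^ (1 / 2 : ℂ) = (starRingEnd ℂ) (z ^ (1 / 2 : ℂ)) := by
    rw [conj_cpow _ _ (slitPlane_arg_ne_pi hz), map_div₀, map_one, map_ofNat]
  have h3 : (√(M.U r θ) : ℂ) = (starRingEnd ℂ) (z ^ (1 / 2 : ℂ)) * z ^ (1 / 2 : ℂ) := by
    rw [mul_comm, mul_conj, normSq_eq_norm_sq]
    congr 1
    rw [Real.sqrt_eq_iff_mul_self_eq (M.U_nonneg _ _) (by positivity), ← sq, ← norm_pow,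
      sq (_ ^ _), cpow_half_mul_self, ← normSq_eq_norm_sq, normSq_apply]
    simp [hzdef, U, -ofReal_cos]
    linear_combination -(M.a ^ 2 * Real.cos θ ^ 2 * hε)
  rw [scale, scale, hc, h2, h3, ← hzdef]
  linear_combination ((M.Δr r ^ (1 / 4 : ℝ) : ℝ) : ℂ) * (starRingEnd ℂ) (z ^ (1 / 2 : ℂ)) *
    cpow_half_mul_self z

/-- Separation of variables in one component of the Dirac equation. -/
theorem separate_component {A B C T R Θ Φ z w s1 s2 s3 e σ f f' g f2 g2 g2' W v u p q d h n K lam : ℂ}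
    (hσ : σ ≠ 0) (he : e ≠ 0) (hu : u ≠ 0) (hp : p ≠ 0)
    (hA : A = e * (f * g) / σ) (hB : B = e * (f2 * g2) / σ) (hC : C = e * (f2 * g) * W / (u * σ))
    (hT : T = -I * K / (u * p) * A)
    (hR : R = p / u * (e * g * f' / σ - (d / (4 * p ^ 2) + 1 / (2 * W)) * A))
    (hΘ : Θ = q / u * (e * f2 * g2' / σ - v / 2 * B))
    (hΦ : Φ = I * n / u * B)
    (hz : z = p / u * (1 / W + d / (2 * p ^ 2)) / 2)
    (hw : w = q / u * (v + 2 * h) / 2)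
    (hrow : -T + s1 * (R + z * A) + s2 * (Θ + w * B) + s3 * (I * Φ) + I * lam * C = 0) :
    I * K / p * (f * g) + s1 * (p * f' * g) + f2 * (s2 * q * (g2' + h * g2) - s3 * (n * g2))
      + I * lam * W * (f2 * g) = 0 := by
  -- The connection coefficient z cancels the radial logarithmic derivative of the scale exactly; w
  -- does the same in θ up to the remainder h.
  have h1 : R + z * A = p / u * (e * g * f' / σ) := by rw [hR, hz]; ring
  have h2 : Θ + w * B = q / u * (e * f2 * g2' / σ + h * B) := by rw [hΘ, hw]; ring
  rw [h1, h2, hT, hΦ, hC, hA, hB] at hrow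
  have h3 : (u * σ / e) * (-(-I * K / (u * p) * (e * (f * g) / σ)) + s1 * (p / u * (e * g * f' / σ))
      + s2 * (q / u * (e * f2 * g2' / σ + h * (e * (f2 * g2) / σ)))
      + s3 * (I * (I * n / u * (e * (f2 * g2) / σ))) + I * lam * (e * (f2 * g) * W / (u * σ))) = 0 := by
    rw [hrow, mul_zero]
  rw [← h3]
  field_simp
  rw [I_sq]
  ring

/-- The radial function `K(r) = ω (r² + a²) + (k + 1/2) E₊ a + Q r`. -/
def radialK (ω : ℝ) (k : ℤ) (r : ℝ) : ℝ :=
  ω * (r ^ 2 + M.a ^ 2) + (k + 1 / 2) * M.E * M.a + r * M.Q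

/-- The two equations sharing an angular factor g have opposite signs s1, opposite angular terms L1
and conjugate W. The part of the mass term with a cos θ joins the angular quotient, so that both
yield the same μ. -/
theorem solve_component {K p f f' g f2 L1 L2 W lam μ r ac : ℂ} {s1 : ℂ} (hs : s1 ^ 2 = 1)
    (hp : p ≠ 0) (hg : g ≠ 0)
    (h : I * K / p * (f * g) + s1 * (p * f' * g) + f2 * L1 + I * lam * W * (f2 * g) = 0)
    (hL : L1 = - s1 * L2) (hW : W = r + s1 * (I * ac)) (hμ : μ = L2 / g + lam * ac) :
    f' = -s1 * I * (K / p ^ 2) * f + (μ - s1 * (I * lam * r)) / p * f2 := by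
  have h1 : s1 * (I * K / p * (f * g) + s1 * (p * f' * g) + f2 * L1 + I * lam * W * (f2 * g)) / (p * g)
      = 0 := by rw [h]; simp
  have h2 : s1 * (I * K / p * (f * g) + s1 * (p * f' * g) + f2 * L1 + I * lam * W * (f2 * g)) / (p * g)
      = s1 * I * (K / p ^ 2) * f + s1 ^ 2 * f' + s1 * f2 * L1 / (p * g)
        + s1 * I * lam * W * f2 / p := by
    field_simp
  rw [h2, hs, hL, hW] at h1
  rw [hμ]
  have h4 : s1 * f2 * (-s1 * L2) / (p * g) = - f2 * (L2 / g) / p := by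
    field_simp
    linear_combination -f2 * L2 * hs
  have h5 : s1 * I * lam * (r + s1 * (I * ac)) * f2 / p
      = s1 * I * lam * r * f2 / p - lam * ac * f2 / p := by
    field_simp
    linear_combination lam * ac * f2 * I ^ 2 * hs + lam * ac * f2 * I_sq
  rw [h4, h5] at h1
  linear_combination h1

theorem radial_ode {rm rp lam ω : ℝ} {k : ℤ} {Xp Xm Yp Ym : ℝ → ℂ} {Ψ : (Fin 4 → ℝ) → Fin 4 → ℂ}
    (hrm : 0 < rm) (hΔ : ∀ r ∈ Set.Ioo rm rp, 0 < M.Δr r)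
    (hform : ∀ x ∈ exterior rm rp, Ψ x = (M.S x)⁻¹ *ᵥ Φ ω k Xp Xm Yp Ym x)
    (hsol : M.IsDiracSolution lam rm rp Ψ) {θ : ℝ} (hθ : θ ∈ Set.Ioo 0 Real.pi)
    (hY : Ym θ ≠ 0 ∨ Yp θ ≠ 0) :
    ∃ μ : ℂ, ∀ r ∈ Set.Ioo rm rp,
      HasDerivAt Xp (I * (M.radialK ω k r / M.Δr r : ℝ) * Xp r
        + (μ + I * lam * r) / (√(M.Δr r) : ℝ) * Xm r) r ∧
      HasDerivAt Xm (-(I * (M.radialK ω k r / M.Δr r : ℝ)) * Xm r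
        + (μ - I * lam * r) / (√(M.Δr r) : ℝ) * Xp r) r := by
  obtain ⟨s, hs⟩ : ∃ s, s = Real.sin θ := ⟨_, rfl⟩
  obtain ⟨co, hco⟩ : ∃ co, co = Real.cos θ := ⟨_, rfl⟩
  obtain ⟨q, hq⟩ : ∃ q, q = √(M.Δθ θ) := ⟨_, rfl⟩
  have hs0 : 0 < s := hs ▸ Real.sin_pos_of_pos_of_lt_pi hθ.1 hθ.2
  have hq0 : 0 < q := hq ▸ Real.sqrt_pos.2 (M.Δθ_pos θ)
  set n : ℂ := (M.a * s * ω + M.E * (k + 1 / 2) / s - M.P * co / s) / q with hn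
  -- This is half the logarithmic derivative of √Δ₊(θ) sin θ.
  set h : ℂ := (co / s - M.κ ^ 2 * M.a ^ 2 * co * s / q ^ 2) / 2 with hh
  -- the four separated equations
  have key : ∀ r ∈ Set.Ioo rm rp, ((Ym θ ≠ 0 ∨ Yp θ ≠ 0) →
        DifferentiableAt ℝ Xp r ∧ DifferentiableAt ℝ Xm r) ∧
      (I * M.radialK ω k r / √(M.Δr r) * (Xp r * Ym θ) + (-1) * (√(M.Δr r) * deriv Xp r * Ym θ)
        + Xm r * (1 * q * (deriv Yp θ + h * Yp θ) - 1 * (n * Yp θ))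
        + I * lam * (r + ((-1 : ℝ) : ℂ) * (I * M.a * co)) * (Xm r * Ym θ) = 0) ∧
      (I * M.radialK ω k r / √(M.Δr r) * (Xm r * Yp θ) + 1 * (√(M.Δr r) * deriv Xm r * Yp θ)
        + Xp r * (1 * q * (deriv Ym θ + h * Ym θ) - (-1) * (n * Ym θ))
        + I * lam * (r + ((-1 : ℝ) : ℂ) * (I * M.a * co)) * (Xp r * Yp θ) = 0) ∧
      (I * M.radialK ω k r / √(M.Δr r) * (Xm r * Ym θ) + 1 * (√(M.Δr r) * deriv Xm r * Ym θ)
        + Xp r * ((-1) * q * (deriv Yp θ + h * Yp θ) - (-1) * (n * Yp θ))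
        + I * lam * (r + ((1 : ℝ) : ℂ) * (I * M.a * co)) * (Xp r * Ym θ) = 0) ∧
      (I * M.radialK ω k r / √(M.Δr r) * (Xp r * Yp θ) + (-1) * (√(M.Δr r) * deriv Xp r * Yp θ)
        + Xm r * ((-1) * q * (deriv Ym θ + h * Ym θ) - 1 * (n * Ym θ))
        + I * lam * (r + ((1 : ℝ) : ℂ) * (I * M.a * co)) * (Xm r * Yp θ) = 0) := by
    intro r hr
    have hr0 : 0 < r := hrm.trans hr.1
    have hΔr := hΔ r hr
    -- The phase cancels from every equation, so t and φ may be any admissible values.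
    set x : Fin 4 → ℝ := ![0, r, θ, Real.pi] with hx
    have hxe : x ∈ exterior rm rp := by
      refine ⟨hr, hθ, Real.pi_pos, ?_⟩
      simp [hx]; linarith [Real.pi_pos]
    have hxc : x ∈ M.chart := ⟨hr0, hΔr, hs ▸ hs0⟩
    have hx1 : x 1 = r := rfl
    have hx2 : x 2 = θ := rfl
    have hc := fun y hy => M.components_eq hrm hΔ hform (y := y) hy
    have hdiff : ∀ j, DifferentiableAt ℝ (fun y => Ψ y j) x :=
      differentiableAt_pi.1 (hsol x hxe).1
    obtain ⟨t0, φ0, r0, θ0, d0, -⟩ := M.fderiv_separated hxe hr0 hΔr (hdiff 0)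
      fun y hy => (hc y hy).1
    obtain ⟨t1, φ1, r1, θ1, d1, -⟩ := M.fderiv_separated hxe hr0 hΔr (hdiff 1)
      fun y hy => (hc y hy).2.1
    obtain ⟨t2, φ2, r2, θ2, d2, -⟩ := M.fderiv_separated hxe hr0 hΔr (hdiff 2)
      fun y hy => (hc y hy).2.2.1
    obtain ⟨t3, φ3, r3, θ3, d3, -⟩ := M.fderiv_separated hxe hr0 hΔr (hdiff 3)
      fun y hy => (hc y hy).2.2.2
    refine ⟨fun hY => hY.elim (fun hY => ⟨d2 hY, d0 hY⟩) fun hY => ⟨d1 hY, d3 hY⟩, ?_⟩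
    obtain ⟨p, hp⟩ : ∃ p, p = √(M.Δr r) := ⟨_, rfl⟩
    obtain ⟨u, hu⟩ : ∃ u, u = √(M.U r θ) := ⟨_, rfl⟩
    have hp0 : (p : ℂ) ≠ 0 := by
      rw [hp]; exact_mod_cast (Real.sqrt_pos.2 hΔr).ne'
    have hu0 : (u : ℂ) ≠ 0 := by
      rw [hu]; exact_mod_cast (Real.sqrt_pos.2 (M.U_pos hr0 θ)).ne'
    have hs0' : (s : ℂ) ≠ 0 := by exact_mod_cast hs0.ne'
    have hq0' : (q : ℂ) ≠ 0 := by exact_mod_cast hq0.ne'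
    have he : phase ω k (x 0) (x 3) ≠ 0 := exp_ne_zero _
    have hσ := fun ε => M.scale_ne_zero hr0 hΔr ε θ
    have hW := fun ε => M.ofReal_add_ne_zero hr0 ε θ
    have hp2 : (M.Δr r : ℂ) = (p : ℂ) ^ 2 := by
      rw [hp]; exact_mod_cast (Real.sq_sqrt hΔr.le).symm
    have hu2 : (u : ℂ) ^ 2 = (r + ((1 : ℝ) : ℂ) * (I * M.a * co)) * (r + ((-1 : ℝ) : ℂ) * (I * M.a * co)) := by
      have : u ^ 2 = r ^ 2 + M.a ^ 2 * co ^ 2 := by rw [hu, Real.sq_sqrt (M.U_nonneg _ _), U, hco]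
      have this' : (u : ℂ) ^ 2 = r ^ 2 + M.a ^ 2 * co ^ 2 := by exact_mod_cast this
      push_cast
      linear_combination this' + (M.a ^ 2 * co ^ 2) * I_sq
    have hsc1 := M.scale_mul_sqrt_U hr0 1 (by norm_num) θ
    have hsc2 := M.scale_mul_sqrt_U hr0 (-1) (by norm_num) θ
    rw [neg_neg] at hsc2
    rw [hx1, hx2] at r0 r1 r2 r3 θ0 θ1 θ2 θ3
    obtain ⟨b0, b1, b2, b3⟩ := hc x hxe
    rw [hx1, hx2] at b0 b1 b2 b3
    clear d0 d1 d2 d3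
    obtain ⟨D, hD⟩ : ∃ D : Fin 4 → Fin 4 → ℂ, ∀ i j, D i j
      = fderiv ℝ (fun y => Ψ y j) x (Pi.single i 1) := ⟨_, fun _ _ => rfl⟩
    obtain ⟨T, hT⟩ : ∃ T : Fin 4 → ℂ, ∀ j, T j = (r ^ 2 + M.a ^ 2) / (u * p) * D 0 j
      + M.a * M.E / (u * p) * D 3 j - I * (M.Q * r / (u * p)) * Ψ x j := ⟨_, fun _ => rfl⟩
    obtain ⟨R, hR⟩ : ∃ R : Fin 4 → ℂ, ∀ j, R j = p / u * D 1 j := ⟨_, fun _ => rfl⟩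
    obtain ⟨Θ, hΘ⟩ : ∃ Θ : Fin 4 → ℂ, ∀ j, Θ j = q / u * D 2 j := ⟨_, fun _ => rfl⟩
    obtain ⟨B, hB⟩ : ∃ B : Fin 4 → ℂ, ∀ j, B j = -(M.a * s) / (u * q) * D 0 j
      - M.E / s / (u * q) * D 3 j - I * (M.P * co / (s * u * q)) * Ψ x j := ⟨_, fun _ => rfl⟩
    obtain ⟨z, hz⟩ : ∃ z : ℂ, z = p / u * (r / u ^ 2 + deriv M.Δr (x 1) / (2 * p ^ 2)
      + I * (M.a * co / u ^ 2)) / 2 := ⟨_, rfl⟩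
    obtain ⟨w, hw⟩ : ∃ w : ℂ, w = q / u * ((-M.a ^ 2 * co * s + I * (r * M.a * s)) / u ^ 2
      - M.κ ^ 2 * M.a ^ 2 * co * s / q ^ 2 + co / s) / 2 := ⟨_, rfl⟩
    obtain ⟨row0, row1, row2, row3⟩ := M.dirac_components hsol hxc hxe (r := r) hx1.symm hs hco
      hu hp hq hD hT hR hΘ hB hz hw
    simp only [← hD] at t0 t1 t2 t3 φ0 φ1 φ2 φ3 r0 r1 r2 r3 θ0 θ1 θ2 θ3
    rw [← hco] at r0 r1 r2 r3 θ0 θ1 θ2 θ3 hsc1 hsc2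
    rw [← hs] at θ0 θ1 θ2 θ3
    rw [hp2] at r0 r1 r2 r3
    rw [← hu] at hsc1 hsc2
    simp only [← hco] at hW
    rw [hx1] at hz
    rw [← hp]
    have hW1 := hW 1
    have hW2 := hW (-1)
    have hTj : ∀ j, D 0 j = -I * ω * Ψ x j → D 3 j = -I * (k + 1 / 2) * Ψ x j →
        T j = -I * M.radialK ω k r / (u * p) * Ψ x j := by
      intro j h0 h3
      rw [hT, h0, h3, radialK]
      push_cast
      ring
    have hBj : ∀ j, D 0 j = -I * ω * Ψ x j → D 3 j = -I * (k + 1 / 2) * Ψ x j →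
        B j = I * n / u * Ψ x j := by
      intro j h0 h3
      rw [hB, h0, h3, hn]
      field_simp
      ring
    -- Factoring U turns the connection coefficients into the logarithmic derivatives of `scale`.
    have hwm : (r + I * (M.a * co)) / (u : ℂ) ^ 2
        = 1 / (r + ((-1 : ℝ) : ℂ) * (I * M.a * co)) := by
      rw [hu2, div_eq_div_iff (mul_ne_zero hW1 hW2) hW2]
      push_cast
      ring
    have hwm' : (-M.a ^ 2 * co * s + I * (r * M.a * s)) / (u : ℂ) ^ 2
        = -(((-1 : ℝ) : ℂ) * (I * M.a * s)) / (r + ((-1 : ℝ) : ℂ) * (I * M.a * co)) := by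
      rw [hu2, div_eq_div_iff (mul_ne_zero hW1 hW2) hW2]
      push_cast
      linear_combination -(M.a ^ 2 * co * s) * (r + (-1) * (I * M.a * co)) * I_sq
    have hz1 : z = p / u * (1 / (r + ((-1 : ℝ) : ℂ) * (I * M.a * co))
        + deriv M.Δr r / (2 * p ^ 2)) / 2 := by
      rw [← hwm, hz]; ring
    have hz2 : star z = p / u * (1 / (r + ((1 : ℝ) : ℂ) * (I * M.a * co))
        + deriv M.Δr r / (2 * p ^ 2)) / 2 := by
      rw [hz1]; simp
    have hw1 : w = q / u * (-(((-1 : ℝ) : ℂ) * (I * M.a * s)) / (r + ((-1 : ℝ) : ℂ) * (I * M.a * co))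
        + 2 * h) / 2 := by
      rw [hw, hwm', hh]; ring
    have hw2 : star w = q / u * (-(((1 : ℝ) : ℂ) * (I * M.a * s)) / (r + ((1 : ℝ) : ℂ) * (I * M.a * co))
        + 2 * h) / 2 := by
      rw [hw1, hh]; simp
    have hv : ∀ {F e g f : ℂ} {σ : ℂ}, σ ≠ 0 → F * σ = e * (f * g) → F = e * (f * g) / σ :=
      fun h1 h2 => eq_div_of_mul_eq h1 h2
    have q0 := hv (hσ 1) b0
    have q1 := hv (hσ 1) b1
    have q2 := hv (hσ (-1)) b2
    have q3 := hv (hσ (-1)) b3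
    refine ⟨?_, ?_, ?_, ?_⟩
    · refine separate_component (hσ (-1)) he hu0 hp0 q2 q3 ?_ (hTj 2 t2 φ2) ((hR 2).trans ?_)
        ((hΘ 3).trans ?_) (hBj 3 t3 φ3) hz1 hw1 (lam := lam) (C := Ψ x 0) ?_
      · rw [eq_div_iff (mul_ne_zero hu0 (hσ _))]
        linear_combination (r + ((-1 : ℝ) : ℂ) * (I * M.a * co)) * b0 + Ψ x 0 * hsc2
      · rw [r2]
      · rw [θ3]; field_simp
      · linear_combination row0
    · refine separate_component (hσ (-1)) he hu0 hp0 q3 q2 ?_ (hTj 3 t3 φ3) ((hR 3).trans ?_)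
        ((hΘ 2).trans ?_) (hBj 2 t2 φ2) hz1 hw1 (lam := lam) (C := Ψ x 1) ?_
      · rw [eq_div_iff (mul_ne_zero hu0 (hσ _))]
        linear_combination (r + ((-1 : ℝ) : ℂ) * (I * M.a * co)) * b1 + Ψ x 1 * hsc2
      · rw [r3]
      · rw [θ2]; field_simp
      · linear_combination row1
    · refine separate_component (hσ 1) he hu0 hp0 q0 q1 ?_ (hTj 0 t0 φ0) ((hR 0).trans ?_)
        ((hΘ 1).trans ?_) (hBj 1 t1 φ1) hz2 hw2 (lam := lam) (C := Ψ x 2) ?_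
      · rw [eq_div_iff (mul_ne_zero hu0 (hσ _))]
        linear_combination (r + ((1 : ℝ) : ℂ) * (I * M.a * co)) * b2 + Ψ x 2 * hsc1
      · rw [r0]
      · rw [θ1]; field_simp
      · linear_combination row2
    · refine separate_component (hσ 1) he hu0 hp0 q1 q0 ?_ (hTj 1 t1 φ1) ((hR 1).trans ?_)
        ((hΘ 0).trans ?_) (hBj 0 t0 φ0) hz2 hw2 (lam := lam) (C := Ψ x 3) ?_
      · rw [eq_div_iff (mul_ne_zero hu0 (hσ _))]
        linear_combination (r + ((1 : ℝ) : ℂ) * (I * M.a * co)) * b3 + Ψ x 3 * hsc1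
      · rw [r1]
      · rw [θ0]; field_simp
      · linear_combination row3
  have hp0 : ∀ r ∈ Set.Ioo rm rp, ((√(M.Δr r) : ℝ) : ℂ) ≠ 0 := fun r hr => by
    exact_mod_cast (Real.sqrt_pos.2 (hΔ r hr)).ne'
  have hp2 : ∀ r ∈ Set.Ioo rm rp, ((M.radialK ω k r / M.Δr r : ℝ) : ℂ)
      = M.radialK ω k r / ((√(M.Δr r) : ℝ) : ℂ) ^ 2 := fun r hr => by
    rw [← ofReal_pow, Real.sq_sqrt (hΔ r hr).le, ofReal_div]
  rcases hY with hg | hg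
  -- θ is fixed, so this quotient is a constant in r; its independence of θ is not needed.
  · refine ⟨(q * (deriv Yp θ + h * Yp θ) - n * Yp θ) / Ym θ + lam * (M.a * co), fun r hr => ?_⟩
    obtain ⟨hd, e0, -, e2, -⟩ := key r hr
    have f0 := solve_component (s1 := -1) (by norm_num) (hp0 r hr) hg e0
      (L2 := q * (deriv Yp θ + h * Yp θ) - n * Yp θ) (by ring)
      (ac := M.a * co) (by push_cast; ring) rfl
    have f2 := solve_component (s1 := 1) (by norm_num) (hp0 r hr) hg e2
      (L2 := q * (deriv Yp θ + h * Yp θ) - n * Yp θ) (by ring)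
      (ac := M.a * co) (by push_cast; ring) rfl
    rw [hp2 r hr]
    exact ⟨(hd (Or.inl hg)).1.hasDerivAt.congr_deriv (f0.trans (by ring)),
      (hd (Or.inl hg)).2.hasDerivAt.congr_deriv (f2.trans (by ring))⟩
  · refine ⟨-(q * (deriv Ym θ + h * Ym θ) + n * Ym θ) / Yp θ - lam * (M.a * co), fun r hr => ?_⟩
    obtain ⟨hd, -, e1, -, e3⟩ := key r hr
    have f3 := solve_component (s1 := -1) (by norm_num) (hp0 r hr) hg e3
      (L2 := -(q * (deriv Ym θ + h * Ym θ) + n * Ym θ)) (by ring)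
      (ac := -(M.a * co)) (by push_cast; ring) rfl
    have f1 := solve_component (s1 := 1) (by norm_num) (hp0 r hr) hg e1
      (L2 := -(q * (deriv Ym θ + h * Ym θ) + n * Ym θ)) (by ring)
      (ac := -(M.a * co)) (by push_cast; ring) rfl
    rw [hp2 r hr]
    exact ⟨(hd (Or.inr hg)).1.hasDerivAt.congr_deriv (f3.trans (by ring)),
      (hd (Or.inr hg)).2.hasDerivAt.congr_deriv (f1.trans (by ring))⟩

/-! ### Energy estimates for the radial system. -/

/-- Gronwall read backwards: f(r) e^(-Cr) decreases, so a bound on the growth of f to the right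
bounds it from below at the left end. -/
theorem le_of_deriv_le_mul {f f' : ℝ → ℝ} {C a b : ℝ} (hab : a ≤ b)
    (hf : ∀ r ∈ Set.Icc a b, HasDerivAt f (f' r) r) (h : ∀ r ∈ Set.Icc a b, f' r ≤ C * f r) :
    f b * Real.exp (-C * (b - a)) ≤ f a := by
  have hg : ∀ r ∈ Set.Icc a b, HasDerivAt (fun r => f r * Real.exp (-C * r))
      ((f' r - C * f r) * Real.exp (-C * r)) r := fun r hr => by
    have h1 : HasDerivAt (fun r => Real.exp (-C * r)) (Real.exp (-C * r) * -C) r := by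
      simpa using ((hasDerivAt_id r).const_mul (-C)).exp
    exact ((hf r hr).mul h1).congr_deriv (by ring)
  have hanti : AntitoneOn (fun r => f r * Real.exp (-C * r)) (Set.Icc a b) := by
    refine antitoneOn_of_deriv_nonpos (convex_Icc a b)
      (fun r hr => (hg r hr).continuousAt.continuousWithinAt)
      (fun r hr => (hg r (interior_subset hr)).differentiableAt.differentiableWithinAt)
      fun r hr => ?_
    rw [(hg r (interior_subset hr)).deriv]
    exact mul_nonpos_of_nonpos_of_nonneg (by linarith [h r (interior_subset hr)])
      (Real.exp_pos _).le
  have h2 := hanti (Set.left_mem_Icc.2 hab) (Set.right_mem_Icc.2 hab) hab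
  have h3 : Real.exp (-C * (b - a)) = Real.exp (-C * b) * Real.exp (C * a) := by
    rw [← Real.exp_add]; ring_nf
  have h4 : Real.exp (-C * a) * Real.exp (C * a) = 1 := by
    rw [← Real.exp_add]; simp
  calc f b * Real.exp (-C * (b - a)) = (f b * Real.exp (-C * b)) * Real.exp (C * a) := by
        rw [h3]; ring
    _ ≤ (f a * Real.exp (-C * a)) * Real.exp (C * a) := by
        gcongr
    _ = f a := by rw [mul_assoc, h4, mul_one]

section RadialSystem

variable {Xp Xm β₁ β₂ : ℝ → ℂ} {K p : ℝ → ℝ} {r : ℝ}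

/-- The singular coefficients ±iK/p² are imaginary, so they do not change the norms. -/
theorem hasDerivAt_normSq_add (hXp : HasDerivAt Xp (I * (K r / p r ^ 2 : ℝ) * Xp r
      + β₁ r / p r * Xm r) r)
    (hXm : HasDerivAt Xm (-(I * (K r / p r ^ 2 : ℝ)) * Xm r + β₂ r / p r * Xp r) r) :
    HasDerivAt (fun r => ‖Xp r‖ ^ 2 + ‖Xm r‖ ^ 2)
      (2 * ((β₁ r + star (β₂ r)) / p r * (Xm r * star (Xp r))).re) r := by
  refine ((hXp.norm_sq).add hXm.norm_sq).congr_deriv ?_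
  simp only [Complex.inner, ← mul_add, ← Complex.add_re]
  set ζ := β₂ r / p r * Xp r * (starRingEnd ℂ) (Xm r) with hζ
  have h1 : (I * (K r / p r ^ 2 : ℝ) * Xp r + β₁ r / p r * Xm r) * (starRingEnd ℂ) (Xp r)
      + (-(I * (K r / p r ^ 2 : ℝ)) * Xm r + β₂ r / p r * Xp r) * (starRingEnd ℂ) (Xm r)
      = I * (K r / p r ^ 2 * (normSq (Xp r) - normSq (Xm r)) : ℝ)
        + (β₁ r / p r * Xm r * (starRingEnd ℂ) (Xp r) + ζ) := by
    push_cast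
    rw [hζ, normSq_eq_conj_mul_self, normSq_eq_conj_mul_self]
    ring
  have h2 : (β₁ r + star (β₂ r)) / p r * (Xm r * star (Xp r))
      = β₁ r / p r * Xm r * (starRingEnd ℂ) (Xp r) + (starRingEnd ℂ) ζ := by
    simp only [hζ, star_def, map_mul, map_div₀, conj_ofReal, conj_conj]
    ring
  rw [h1, h2, add_re, add_re, add_re, conj_re, I_mul_re, ofReal_im]
  ring

/-- X₋ and conj X₊ rotate in the same sense, so the rates add up to -2K/p². This is the oscillation
that the corrected energy uses. -/
theorem hasDerivAt_mul_star (hXp : HasDerivAt Xp (I * (K r / p r ^ 2 : ℝ) * Xp r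
      + β₁ r / p r * Xm r) r)
    (hXm : HasDerivAt Xm (-(I * (K r / p r ^ 2 : ℝ)) * Xm r + β₂ r / p r * Xp r) r) :
    HasDerivAt (fun r => Xm r * star (Xp r))
      (-(2 * I * (K r / p r ^ 2 : ℝ)) * (Xm r * star (Xp r))
        + (β₂ r * (‖Xp r‖ : ℂ) ^ 2 + star (β₁ r) * (‖Xm r‖ : ℂ) ^ 2) / p r) r := by
  refine (hXm.mul hXp.star).congr_deriv ?_
  have h1 := Complex.mul_conj' (Xp r)
  have h2 := Complex.mul_conj' (Xm r)
  rw [← h1, ← h2]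
  simp only [star_def, map_mul, map_add, map_div₀, map_neg, conj_I, conj_ofReal]
  ring

theorem two_mul_norm_mul_star_le (z w : ℂ) : 2 * ‖w * star z‖ ≤ ‖z‖ ^ 2 + ‖w‖ ^ 2 := by
  rw [norm_mul, norm_star]
  nlinarith [sq_nonneg (‖z‖ - ‖w‖)]

end RadialSystem

/-- On a compact interval avoiding the zeros of p the coefficient 1/p is bounded, and plain Gronwall
shows that a nonzero solution stays nonzero. -/
theorem radial_ne_zero {Xp Xm β₁ β₂ : ℝ → ℂ} {K p : ℝ → ℝ} {a b : ℝ} (hab : a ≤ b)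
    (hXp : ∀ r ∈ Set.Icc a b, HasDerivAt Xp (I * (K r / p r ^ 2 : ℝ) * Xp r
      + β₁ r / p r * Xm r) r)
    (hXm : ∀ r ∈ Set.Icc a b, HasDerivAt Xm (-(I * (K r / p r ^ 2 : ℝ)) * Xm r
      + β₂ r / p r * Xp r) r)
    (hβ₁ : ContinuousOn β₁ (Set.Icc a b)) (hβ₂ : ContinuousOn β₂ (Set.Icc a b))
    (hp : ContinuousOn p (Set.Icc a b)) (hp0 : ∀ r ∈ Set.Icc a b, p r ≠ 0)
    (hb : 0 < ‖Xp b‖ ^ 2 + ‖Xm b‖ ^ 2) : 0 < ‖Xp a‖ ^ 2 + ‖Xm a‖ ^ 2 := by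
  have hc : ContinuousOn (fun r => ‖(β₁ r + star (β₂ r)) / p r‖) (Set.Icc a b) := by
    refine ContinuousOn.norm (ContinuousOn.div (hβ₁.add hβ₂.star)
      (continuous_ofReal.comp_continuousOn hp) fun r hr => ?_)
    exact_mod_cast hp0 r hr
  obtain ⟨C, hC⟩ := (isCompact_Icc.image_of_continuousOn hc).bddAbove
  refine lt_of_lt_of_le ?_ (le_of_deriv_le_mul (f := fun r => ‖Xp r‖ ^ 2 + ‖Xm r‖ ^ 2) (C := C) hab
    (fun r hr => hasDerivAt_normSq_add (hXp r hr) (hXm r hr)) fun r hr => ?_)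
  · positivity
  · have h1 : ‖(β₁ r + star (β₂ r)) / p r‖ ≤ C := hC ⟨r, hr, rfl⟩
    have h2 := two_mul_norm_mul_star_le (Xp r) (Xm r)
    calc 2 * ((β₁ r + star (β₂ r)) / p r * (Xm r * star (Xp r))).re
        ≤ 2 * ‖(β₁ r + star (β₂ r)) / p r * (Xm r * star (Xp r))‖ := by
          gcongr; exact re_le_norm _
      _ = ‖(β₁ r + star (β₂ r)) / p r‖ * (2 * ‖Xm r * star (Xp r)‖) := by
          rw [norm_mul]; ring
      _ ≤ C * (‖Xp r‖ ^ 2 + ‖Xm r‖ ^ 2) := by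
          have := (norm_nonneg _).trans h1
          gcongr

/-- If `K` does not vanish at the double root of `p²`, the solutions of the radial system do not
decay there. -/
theorem radial_lower_bound {Xp Xm β₁ β₂ : ℝ → ℂ} {K p : ℝ → ℝ} {a b : ℝ}
    (hXp : ∀ r ∈ Set.Ioo a b, HasDerivAt Xp (I * (K r / p r ^ 2 : ℝ) * Xp r
      + β₁ r / p r * Xm r) r)
    (hXm : ∀ r ∈ Set.Ioo a b, HasDerivAt Xm (-(I * (K r / p r ^ 2 : ℝ)) * Xm r
      + β₂ r / p r * Xp r) r)
    (hβ₁ : ContDiff ℝ 1 β₁) (hβ₂ : ContDiff ℝ 1 β₂) (hK : ContDiffAt ℝ 1 K a)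
    (hp : ContDiffAt ℝ 1 p a) (hpc : ContinuousOn p (Set.Ioo a b))
    (hp0 : ∀ r ∈ Set.Ioo a b, p r ≠ 0) (hpa : p a = 0) (hKa : K a ≠ 0)
    {r₀ : ℝ} (hr₀ : r₀ ∈ Set.Ioo a b) (hX : 0 < ‖Xp r₀‖ ^ 2 + ‖Xm r₀‖ ^ 2) :
    ∃ c > 0, ∀ᶠ r in nhdsWithin a (Set.Ioi a), c ≤ ‖Xp r‖ ^ 2 + ‖Xm r‖ ^ 2 := by
  -- G = pB is chosen so that G · (-2iK/p²) = -2(β₁ + conj β₂)/p, which cancels the nonintegrable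
  -- term of N'.
  set B : ℝ → ℂ := fun r => (β₁ r + star (β₂ r)) / (I * K r) with hB
  set G : ℝ → ℂ := fun r => p r * B r with hG
  have hofReal : ContDiff ℝ 1 (fun x : ℝ => (x : ℂ)) := ofRealCLM.contDiff
  have hKc : ContDiffAt ℝ 1 (fun r => (K r : ℂ)) a := hofReal.contDiffAt.comp a hK
  have hpC : ContDiffAt ℝ 1 (fun r => (p r : ℂ)) a := hofReal.contDiffAt.comp a hp
  have hβ₂s : ContDiff ℝ 1 (fun r => star (β₂ r)) := by
    exact (conjCLE.contDiff (n := 1)).comp hβ₂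
  have hBd : ContDiffAt ℝ 1 B a := by
    have h0 : I * (K a : ℂ) ≠ 0 := by simpa using hKa
    have h1 : ContDiffAt ℝ 1 (fun r => (β₁ r + star (β₂ r)) * (I * (K r : ℂ))⁻¹) a :=
      (hβ₁.contDiffAt.add hβ₂s.contDiffAt).mul ((contDiffAt_const.mul hKc).inv h0)
    simpa only [hB, div_eq_mul_inv] using h1
  have hGd : ContDiffAt ℝ 1 G a := hpC.mul hBd
  have hG1 : ∀ᶠ r in nhds a, DifferentiableAt ℝ G r := by
    have := hGd.eventually (by simp)
    exact this.mono fun r hr => hr.differentiableAt (by simp)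
  have hG2 : ∀ᶠ r in nhds a, ‖deriv G r‖ < ‖deriv G a‖ + 1 := by
    have hcont : ContinuousAt (deriv G) a := by
      have h1 := hGd.continuousAt_fderiv (by simp)
      exact h1.clm_apply continuousAt_const
    exact (hcont.norm.tendsto.eventually_lt_const (by linarith))
  have hG3 : ∀ᶠ r in nhds a, ‖G r‖ < 1 := by
    have : ‖G a‖ < 1 := by simp [hG, hpa]
    exact hGd.continuousAt.norm.tendsto.eventually_lt_const this
  set H : ℝ → ℝ := fun r => ‖B r‖ * (‖β₁ r‖ + ‖β₂ r‖) with hH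
  have hH1 : ∀ᶠ r in nhds a, H r < H a + 1 := by
    have : ContinuousAt H a := hBd.continuousAt.norm.mul
      (hβ₁.continuous.norm.add hβ₂.continuous.norm).continuousAt
    exact this.tendsto.eventually_lt_const (by linarith)
  have hK1 : ∀ᶠ r in nhds a, K r ≠ 0 := hK.continuousAt.eventually_ne hKa
  obtain ⟨δ, hδ, hball⟩ := Metric.eventually_nhds_iff.1
    (hG1.and (hG2.and (hG3.and (hH1.and hK1))))
  set d := min (a + δ) r₀ with hd
  have had : a < d := lt_min (by linarith) hr₀.1
  -- a point to the left of which the estimates hold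
  obtain ⟨r₁, hr₁a, hr₁d⟩ := exists_between had
  have hr₁b : r₁ < b := hr₁d.trans_le ((min_le_right _ _).trans hr₀.2.le)
  have hnear : ∀ r ∈ Set.Ioc a r₁, r ∈ Set.Ioo a b ∧ DifferentiableAt ℝ G r ∧
      ‖deriv G r‖ < ‖deriv G a‖ + 1 ∧ ‖G r‖ < 1 ∧ H r < H a + 1 ∧ K r ≠ 0 := by
    intro r hr
    refine ⟨⟨hr.1, hr.2.trans_lt hr₁b⟩, hball ?_⟩
    rw [Real.dist_eq, abs_of_pos (by linarith [hr.1])]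
    have := hr.2.trans_lt (hr₁d.trans_le (min_le_left _ _))
    linarith
  have hX₁ : 0 < ‖Xp r₁‖ ^ 2 + ‖Xm r₁‖ ^ 2 := by
    have hle : r₁ ≤ r₀ := hr₁d.le.trans (min_le_right _ _)
    have hsub : Set.Icc r₁ r₀ ⊆ Set.Ioo a b := fun r hr =>
      ⟨hr₁a.trans_le hr.1, hr.2.trans_lt hr₀.2⟩
    exact radial_ne_zero hle (fun r hr => hXp r (hsub hr)) (fun r hr => hXm r (hsub hr))
      hβ₁.continuous.continuousOn hβ₂.continuous.continuousOn (hpc.mono hsub)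
      (fun r hr => hp0 r (hsub hr)) hX
  -- the corrected energy
  set N : ℝ → ℝ := fun r => ‖Xp r‖ ^ 2 + ‖Xm r‖ ^ 2 with hN
  set W : ℝ → ℂ := fun r => Xm r * star (Xp r) with hW
  set En : ℝ → ℝ := fun r => N r + (G r * W r).re with hEn
  set V : ℝ → ℂ := fun r => β₂ r * (‖Xp r‖ : ℂ) ^ 2 + star (β₁ r) * (‖Xm r‖ : ℂ) ^ 2 with hV
  have hEn' : ∀ r ∈ Set.Ioc a r₁,
      HasDerivAt En ((deriv G r * W r + B r * V r).re) r := by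
    intro r hr
    obtain ⟨hrab, hGr, -, -, -, hKr⟩ := hnear r hr
    have h1 := hasDerivAt_normSq_add (hXp r hrab) (hXm r hrab)
    have h2 := hasDerivAt_mul_star (hXp r hrab) (hXm r hrab)
    have h3 := (hGr.hasDerivAt.mul h2)
    have h4 : HasDerivAt (fun r => (G r * W r).re) _ r :=
      (reCLM.hasFDerivAt.comp_hasDerivAt r h3)
    refine (h1.add h4).congr_deriv ?_
    have hpr : (p r : ℂ) ≠ 0 := by exact_mod_cast hp0 r hrab
    have hKr' : (K r : ℂ) ≠ 0 := by exact_mod_cast hKr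
    have h5 : ∀ z : ℂ, 2 * z.re = (2 * z).re := fun z => by simp
    rw [reCLM_apply, h5, ← add_re]
    congr 1
    simp only [hG, hB, hV, hW]
    push_cast
    field_simp
    ring
  have hWN : ∀ r, ‖W r‖ ≤ N r / 2 := fun r => by
    have := two_mul_norm_mul_star_le (Xp r) (Xm r)
    simp only [hW, hN]; linarith
  have hN0 : ∀ r, 0 ≤ N r := fun r => by positivity
  have hcmp : ∀ r ∈ Set.Ioc a r₁, |En r - N r| ≤ N r / 2 := by
    intro r hr
    have h1 : En r - N r = (G r * W r).re := by simp [hEn]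
    rw [h1]
    calc |(G r * W r).re| ≤ ‖G r * W r‖ := abs_re_le_norm _
      _ = ‖G r‖ * ‖W r‖ := norm_mul _ _
      _ ≤ 1 * (N r / 2) := by
        gcongr
        · exact (hnear r hr).2.2.2.1.le
        · exact hWN r
      _ = N r / 2 := one_mul _
  set C := ‖deriv G a‖ + 1 + (H a + 1) with hC
  have hHa : 0 ≤ H a := by positivity
  have hC0 : 0 ≤ C := by positivity
  have hle : ∀ r ∈ Set.Ioc a r₁, (deriv G r * W r + B r * V r).re ≤ (2 * C) * En r := by
    intro r hr
    obtain ⟨-, -, h1, -, h2, -⟩ := hnear r hr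
    have h3 : ‖V r‖ ≤ (‖β₁ r‖ + ‖β₂ r‖) * N r := by
      calc ‖V r‖ ≤ ‖β₂ r‖ * ‖Xp r‖ ^ 2 + ‖β₁ r‖ * ‖Xm r‖ ^ 2 := by
            refine (norm_add_le _ _).trans (le_of_eq ?_)
            simp
        _ ≤ (‖β₁ r‖ + ‖β₂ r‖) * N r := by
            simp only [hN]
            nlinarith [mul_nonneg (norm_nonneg (β₁ r)) (sq_nonneg ‖Xp r‖),
              mul_nonneg (norm_nonneg (β₂ r)) (sq_nonneg ‖Xm r‖)]
    -- From |En - N| ≤ N/2, which also gives En ≤ 2N for the final bound.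
    have h4 : N r ≤ 2 * En r := by linarith [(abs_le.1 (hcmp r hr)).1]
    calc (deriv G r * W r + B r * V r).re ≤ ‖deriv G r * W r + B r * V r‖ := re_le_norm _
      _ ≤ ‖deriv G r‖ * ‖W r‖ + ‖B r‖ * ‖V r‖ := by
          refine (norm_add_le _ _).trans (le_of_eq ?_)
          rw [norm_mul, norm_mul (B r)]
      _ ≤ (‖deriv G a‖ + 1) * N r + ‖B r‖ * ((‖β₁ r‖ + ‖β₂ r‖) * N r) := by
          have := (hWN r).trans (by linarith [hN0 r] : _ ≤ N r)
          gcongr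
      _ = (‖deriv G a‖ + 1) * N r + H r * N r := by simp only [hH]; ring
      _ ≤ (‖deriv G a‖ + 1) * N r + (H a + 1) * N r := by
          have := hN0 r
          gcongr
      _ = C * N r := by rw [hC]; ring
      _ ≤ C * (2 * En r) := by gcongr
      _ = 2 * C * En r := by ring
  have hE₁ : 0 < En r₁ := by
    have := (abs_le.1 (hcmp r₁ ⟨hr₁a, le_rfl⟩)).1
    have h2 : 0 < N r₁ := hX₁
    linarith
  -- Gronwall is used over the whole length r₁ - a to make the constant independent of r; the factor
  -- 1/2 passes from En back to N.
  refine ⟨En r₁ * Real.exp (-(2 * C) * (r₁ - a)) / 2, by positivity, ?_⟩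
  filter_upwards [Ioo_mem_nhdsGT hr₁a] with r hr
  have hsub : Set.Icc r r₁ ⊆ Set.Ioc a r₁ := fun y hy => ⟨hr.1.trans_le hy.1, hy.2⟩
  have h1 := le_of_deriv_le_mul hr.2.le (fun y hy => hEn' y (hsub hy)) fun y hy => hle y (hsub hy)
  have h2 : Real.exp (-(2 * C) * (r₁ - a)) ≤ Real.exp (-(2 * C) * (r₁ - r)) := by
    apply Real.exp_le_exp.2
    nlinarith [hr.1]
  have h3 := (abs_le.1 (hcmp r ⟨hr.1, hr.2.le⟩)).2
  have h4 : En r₁ * Real.exp (-(2 * C) * (r₁ - a)) ≤ En r := (by gcongr : _ ≤ _).trans h1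
  have h5 := hN0 r
  change _ ≤ N r
  linarith

/-! ### The extreme horizon and the volume of the slice. -/

open Polynomial in
theorem natDegree_quartic {α β γ δ : ℝ} (hα : α ≠ 0) :
    (C α * X ^ 4 + C β * X ^ 2 + C γ * X + C δ).natDegree = 4 := by
  compute_degree!

open Polynomial in
theorem coeff_four_quartic (α β γ δ : ℝ) :
    (C α * X ^ 4 + C β * X ^ 2 + C γ * X + C δ).coeff 4 = α := by
  simp

-- Four roots in degree four: the polynomial splits, with leading coefficient -κ².
open Polynomial in
theorem IsExtreme.Δr_eq {M : KNdS} {rm rp : ℝ} (h : M.IsExtreme rm rp) (r : ℝ) :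
    M.Δr r = (r - rm) ^ 2 * (M.κ ^ 2 * (rp - r) * (r + 2 * rm + rp)) := by
  have hκ : -M.κ ^ 2 ≠ 0 := neg_ne_zero.2 (pow_ne_zero 2 M.κ_pos.ne')
  have hform : M.ΔrPoly = C (-M.κ ^ 2) * X ^ 4 + C (1 - M.κ ^ 2 * M.a ^ 2) * X ^ 2
      + C (-(2 * M.m)) * X + C (M.a ^ 2 + M.Q ^ 2 + M.P ^ 2) := by
    simp only [ΔrPoly, map_neg, map_sub, map_mul, map_add, map_one, map_pow]
    ring
  have hdeg : M.ΔrPoly.natDegree = 4 := by rw [hform, natDegree_quartic hκ]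
  have hlead : M.ΔrPoly.leadingCoeff = -M.κ ^ 2 := by
    rw [leadingCoeff, hdeg, hform, coeff_four_quartic]
  have h1 := C_leadingCoeff_mul_prod_multiset_X_sub_C (p := M.ΔrPoly) (by rw [h.2.2, hdeg]; rfl)
  rw [← eval_ΔrPoly, ← h1, hlead, h.2.2]
  simp
  ring

/-- The induced metric is diagonal. The rr entry gives the pole 1/Δ₊(r); the last bracket comes from
the φφ entry. -/
theorem det_spatial_metric {x : Fin 4 → ℝ} (hx : x ∈ M.chart) :
    ((M.metric x).submatrix Fin.succ Fin.succ).det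
      = M.U (x 1) (x 2) * Real.sin (x 2) ^ 2 / (M.Δr (x 1) * M.Δθ (x 2) * M.E ^ 2)
        * (M.Δθ (x 2) * ((x 1) ^ 2 + M.a ^ 2) ^ 2 - M.Δr (x 1) * M.a ^ 2 * Real.sin (x 2) ^ 2) := by
  have hU := M.U_pos hx.1 (x 2)
  have hΔ := hx.2.1
  have hθ := M.Δθ_pos (x 2)
  have hE := M.E_pos
  have s1 := (Real.sq_sqrt hU.le).symm
  have s2 := (Real.sq_sqrt hΔ.le).symm
  have s3 := (Real.sq_sqrt hθ.le).symm
  have p1 := Real.sqrt_pos.2 hU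
  have p2 := Real.sqrt_pos.2 hΔ
  have p3 := Real.sqrt_pos.2 hθ
  rw [Matrix.det_fin_three]
  simp [metric, coframe, η, Fin.sum_univ_four, Real.sqrt_div' _ hU.le, Real.sqrt_div' _ hΔ.le,
    Real.sqrt_div' _ hθ.le]
  generalize √(M.U (x 1) (x 2)) = u at *
  generalize √(M.Δr (x 1)) = p at *
  generalize √(M.Δθ (x 2)) = q at *
  rw [s1, s2, s3]
  field_simp
  ring

open MeasureTheory in
theorem lintegral_inv_sub_eq_top {a b c : ℝ} (hab : a < b) (hc : 0 < c) :
    ∫⁻ r in Set.Ioo a b, ENNReal.ofReal (c / (r - a)) = ⊤ := by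
  by_contra hne
  have h1 : IntegrableOn (fun r => c / (r - a)) (Set.Ioo a b) := by
    refine (lintegral_ofReal_ne_top_iff_integrable ?_ ?_).1 hne
    · exact (measurable_const.div (measurable_id.sub_const a)).aestronglyMeasurable
    refine (ae_restrict_iff' measurableSet_Ioo).2 (Filter.Eventually.of_forall fun r hr => ?_)
    have := hr.1
    have : 0 < r - a := by linarith
    exact (div_pos hc this).le
  have h2 : IntervalIntegrable (fun r => (r - a)⁻¹) volume a b := by
    rw [intervalIntegrable_iff_integrableOn_Ioo_of_le hab.le]
    refine (h1.const_mul c⁻¹).congr (Filter.Eventually.of_forall fun r => ?_)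
    simp only
    field_simp
  rw [intervalIntegrable_sub_inv_iff] at h2
  rcases h2 with h2 | h2
  · exact hab.ne h2
  · exact h2 Set.left_mem_uIcc

open MeasureTheory in
theorem sliceVolume_eq_top {rm rp t c δ θ₁ θ₂ : ℝ} (hδ : 0 < δ) (hδp : rm + δ ≤ rp) (hc : 0 < c)
    (hθ₁ : 0 ≤ θ₁) (hθ : θ₁ < θ₂) (hθ₂ : θ₂ ≤ Real.pi)
    (h : ∀ r ∈ Set.Ioo rm (rm + δ), ∀ θ ∈ Set.Ioo θ₁ θ₂, ∀ φ,
      c / (r - rm) ≤ √((M.metric (slicePoint t (r, θ, φ))).submatrix Fin.succ Fin.succ).det) :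
    M.sliceVolume rm rp t
      (Set.Ioo rm (rm + δ) ×ˢ Set.Ioo θ₁ θ₂ ×ˢ Set.Ioo 0 (2 * Real.pi)) = ⊤ := by
  have hms : MeasurableSet (Set.Ioo rm (rm + δ) ×ˢ Set.Ioo θ₁ θ₂ ×ˢ Set.Ioo 0 (2 * Real.pi)) :=
    measurableSet_Ioo.prod (measurableSet_Ioo.prod measurableSet_Ioo)
  rw [sliceVolume, withDensity_apply _ hms, Measure.restrict_restrict hms,
    Set.inter_eq_left.2 (Set.prod_mono (Set.Ioo_subset_Ioo le_rfl hδp)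
      (Set.prod_mono (Set.Ioo_subset_Ioo hθ₁ hθ₂) subset_rfl)), ← top_le_iff]
  calc ⊤ = (∫⁻ r in Set.Ioo rm (rm + δ), ENNReal.ofReal (c / (r - rm)))
        * ∫⁻ _ in Set.Ioo θ₁ θ₂ ×ˢ Set.Ioo 0 (2 * Real.pi), 1 := by
        rw [lintegral_inv_sub_eq_top (by linarith) hc, setLIntegral_one, ENNReal.top_mul]
        rw [Measure.volume_eq_prod, Measure.prod_prod, Real.volume_Ioo, Real.volume_Ioo]
        have := Real.pi_pos
        simp; exact ⟨hθ, this⟩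
    _ = ∫⁻ y in Set.Ioo rm (rm + δ) ×ˢ Set.Ioo θ₁ θ₂ ×ˢ Set.Ioo 0 (2 * Real.pi),
          ENNReal.ofReal (c / (y.1 - rm)) := by
        rw [Measure.volume_eq_prod ℝ (ℝ × ℝ), ← Measure.prod_restrict,
          ← lintegral_prod_mul (by fun_prop) (by fun_prop)]
        simp
    _ ≤ _ := setLIntegral_mono' hms fun y hy => ENNReal.ofReal_le_ofReal (h _ hy.1 _ hy.2.1 _)

/-! ### Lower bounds for the spinor near the horizon. -/

theorem norm_phase (ω : ℝ) (k : ℤ) (t φ : ℝ) : ‖phase ω k t φ‖ = 1 := by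
  have : -I * (ω * t + ((k : ℂ) + 1 / 2) * φ) = ((-(ω * t + ((k : ℝ) + 1 / 2) * φ) : ℝ) : ℂ) * I := by
    push_cast; ring
  rw [phase, this, norm_exp_ofReal_mul_I]

/-- An upper bound on S₊ suffices: dividing by it then cannot make the spinor small. -/
theorem norm_scale_sq_le {r R : ℝ} (hr : 0 < r) (hrR : r ≤ R) (hΔ : 0 < M.Δr r) {ε : ℝ}
    (hε : |ε| = 1) (θ : ℝ) : ‖M.scale ε r θ‖ ^ 2 ≤ √(M.Δr r) * (R + |M.a|) := by
  rw [scale, norm_mul, mul_pow, ← norm_pow, ← norm_pow, sq (_ ^ (1 / 2 : ℂ)), cpow_half_mul_self,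
    ← ofReal_pow, norm_real, ← Real.rpow_natCast, ← Real.rpow_mul hΔ.le]
  have h1 : (1 / 4 : ℝ) * (2 : ℕ) = 1 / 2 := by norm_num
  rw [h1, ← Real.sqrt_eq_rpow, Real.norm_of_nonneg (Real.sqrt_nonneg _)]
  gcongr
  refine (norm_add_le _ _).trans ?_
  simp only [norm_mul, norm_real, Real.norm_eq_abs, hε, norm_I, one_mul, abs_of_pos hr]
  have := Real.abs_cos_le_one θ
  have h2 := abs_nonneg M.a
  nlinarith

/-- A nonzero component of Ψ forces both of its factors to be nonzero, and fixing the radial one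
makes the angular one continuous. This yields the starting radius and an angle near which Y stays
away from zero. -/
theorem exists_angular_ne_zero {rm rp lam ω : ℝ} {k : ℤ} {Xp Xm Yp Ym : ℝ → ℂ}
    {Ψ : (Fin 4 → ℝ) → Fin 4 → ℂ} (hrm : 0 < rm) (hΔ : ∀ r ∈ Set.Ioo rm rp, 0 < M.Δr r)
    (hform : ∀ x ∈ exterior rm rp, Ψ x = (M.S x)⁻¹ *ᵥ Φ ω k Xp Xm Yp Ym x)
    (hsol : M.IsDiracSolution lam rm rp Ψ) {x : Fin 4 → ℝ} (hx : x ∈ exterior rm rp)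
    (hne : Ψ x ≠ 0) :
    0 < ‖Xp (x 1)‖ ^ 2 + ‖Xm (x 1)‖ ^ 2 ∧
    ((Ym (x 2) ≠ 0 ∧ ContinuousAt Ym (x 2)) ∨ (Yp (x 2) ≠ 0 ∧ ContinuousAt Yp (x 2))) := by
  obtain ⟨j, hj⟩ := Function.ne_iff.1 hne
  have hr := hrm.trans hx.1.1
  have hΔx := hΔ _ hx.1
  have hc := fun y hy => M.components_eq hrm hΔ hform (y := y) hy
  have hd : ∀ j, DifferentiableAt ℝ (fun y => Ψ y j) x := differentiableAt_pi.1 (hsol x hx).1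
  have key : ∀ {F : (Fin 4 → ℝ) → ℂ} {ε : ℝ} {f g : ℝ → ℂ}, DifferentiableAt ℝ F x → F x ≠ 0 →
      (∀ y ∈ exterior rm rp, F y * M.scale ε (y 1) (y 2)
        = phase ω k (y 0) (y 3) * (f (y 1) * g (y 2))) →
      f (x 1) ≠ 0 ∧ g (x 2) ≠ 0 ∧ ContinuousAt g (x 2) := by
    intro F ε f g hF hF0 h
    have h0 : f (x 1) * g (x 2) ≠ 0 := fun h0 => by
      have := h x hx
      rw [h0, mul_zero] at this
      exact mul_ne_zero hF0 (M.scale_ne_zero hr hΔx ε _) this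
    have h1 := left_ne_zero_of_mul h0
    exact ⟨h1, right_ne_zero_of_mul h0,
      ((M.fderiv_separated hx hr hΔx hF h).2.2.2.2.2 h1).continuousAt⟩
  have hpos : Xp (x 1) ≠ 0 ∨ Xm (x 1) ≠ 0 → 0 < ‖Xp (x 1)‖ ^ 2 + ‖Xm (x 1)‖ ^ 2 := by
    rintro (h | h)
    · have := norm_pos_iff.2 h
      positivity
    · have := norm_pos_iff.2 h
      positivity
  fin_cases j
  · obtain ⟨h1, h2⟩ := key (hd 0) hj fun y hy => (hc y hy).1
    exact ⟨hpos (Or.inr h1), Or.inl h2⟩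
  · obtain ⟨h1, h2⟩ := key (hd 1) hj fun y hy => (hc y hy).2.1
    exact ⟨hpos (Or.inl h1), Or.inr h2⟩
  · obtain ⟨h1, h2⟩ := key (hd 2) hj fun y hy => (hc y hy).2.2.1
    exact ⟨hpos (Or.inl h1), Or.inl h2⟩
  · obtain ⟨h1, h2⟩ := key (hd 3) hj fun y hy => (hc y hy).2.2.2
    exact ⟨hpos (Or.inr h1), Or.inr h2⟩

/-- Meant for two components sharing an angular factor, one carrying X₊ and the other X₋, so that
together they control the full radial energy. -/
theorem le_norm_spinor_sq {v : Fin 4 → ℂ} {σ₁ σ₂ e X₁ X₂ Y : ℂ} {i j : Fin 4} (hij : i ≠ j) {C : ℝ}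
    (he : ‖e‖ = 1) (h₁ : v i * σ₁ = e * (X₁ * Y)) (h₂ : v j * σ₂ = e * (X₂ * Y))
    (hσ₁ : ‖σ₁‖ ^ 2 ≤ C) (hσ₂ : ‖σ₂‖ ^ 2 ≤ C) :
    (‖X₁‖ ^ 2 + ‖X₂‖ ^ 2) * ‖Y‖ ^ 2 ≤ C * ‖(WithLp.toLp 2 v : EuclideanSpace ℂ (Fin 4))‖ ^ 2 := by
  have hC : 0 ≤ C := (sq_nonneg _).trans hσ₁
  have g : ∀ {w σ X : ℂ}, w * σ = e * (X * Y) → ‖σ‖ ^ 2 ≤ C → ‖X‖ ^ 2 * ‖Y‖ ^ 2 ≤ C * ‖w‖ ^ 2 := by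
    intro w σ X h hσ
    have h1 := congrArg norm h
    rw [norm_mul, norm_mul, norm_mul, he, one_mul] at h1
    rw [← mul_pow, ← h1, mul_pow, mul_comm]
    gcongr
  have h3 : ‖v i‖ ^ 2 + ‖v j‖ ^ 2 ≤ ‖(WithLp.toLp 2 v : EuclideanSpace ℂ (Fin 4))‖ ^ 2 := by
    rw [EuclideanSpace.norm_sq_eq, ← Finset.sum_pair (f := fun i => ‖v i‖ ^ 2) hij]
    exact Finset.sum_le_sum_of_subset_of_nonneg (Finset.subset_univ _) fun _ _ _ => by positivity
  nlinarith [g h₁ hσ₁, g h₂ hσ₂, mul_le_mul_of_nonneg_left h3 hC]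

/-- The volume density of the slice blows up at least like `1 / (r - rm)` at an extreme horizon. -/
theorem le_sqrt_det_spatial_metric {rm rp : ℝ} (hext : M.IsExtreme rm rp) {x : Fin 4 → ℝ}
    (hr : x 1 ∈ Set.Ioo rm rp) {s : ℝ} (hs : 0 < s) (hsx : s ≤ Real.sin (x 2))
    (hsmall : M.a ^ 2 * M.Δr (x 1) ≤ rm ^ 4 / 2) (hΔ : 0 < M.Δr (x 1)) :
    √(rm ^ 2 * s ^ 2 * (rm ^ 4 / 2) / (4 * M.κ ^ 2 * rp ^ 2 * M.E ^ 3)) / (x 1 - rm)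
      ≤ √((M.metric x).submatrix Fin.succ Fin.succ).det := by
  have hrm := hext.1
  have hκ := M.κ_pos
  have hE := M.E_pos
  have hd : 0 < x 1 - rm := sub_pos.2 hr.1
  have hr0 : 0 < x 1 := hrm.trans hr.1
  have hrp : 0 < rp := hr0.trans hr.2
  have hθ := M.Δθ_pos (x 2)
  have hs2 : Real.sin (x 2) ^ 2 ≤ 1 := Real.sin_sq_le_one _
  have hc2 : Real.cos (x 2) ^ 2 ≤ 1 := Real.cos_sq_le_one _
  have hθ1 : 1 ≤ M.Δθ (x 2) := by
    rw [Δθ]; linarith [show 0 ≤ M.κ ^ 2 * M.a ^ 2 * Real.cos (x 2) ^ 2 by positivity]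
  have hθE : M.Δθ (x 2) ≤ M.E := by
    rw [Δθ, E]; nlinarith [show 0 ≤ M.κ ^ 2 * M.a ^ 2 by positivity]
  have hU : rm ^ 2 ≤ M.U (x 1) (x 2) := by
    rw [U]; nlinarith [show 0 ≤ M.a ^ 2 * Real.cos (x 2) ^ 2 by positivity, hr.1]
  -- The cofactor of (r - r₋)² is at most κ² · r₊ · 4r₊.
  have hΔle : M.Δr (x 1) ≤ (x 1 - rm) ^ 2 * (4 * M.κ ^ 2 * rp ^ 2) := by
    rw [hext.Δr_eq]
    refine mul_le_mul_of_nonneg_left ?_ (sq_nonneg _)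
    have h1 : (rp - x 1) * (x 1 + 2 * rm + rp) ≤ rp * (4 * rp) :=
      mul_le_mul (by linarith) (by linarith [hr.1, hr.2]) (by linarith) hrp.le
    nlinarith [mul_le_mul_of_nonneg_left h1 (sq_nonneg M.κ)]
  have hU0 := M.U_nonneg (x 1) (x 2)
  -- Smallness of a²Δ₊(r) keeps the φφ factor positive.
  have hbr : rm ^ 4 / 2 ≤ M.Δθ (x 2) * ((x 1) ^ 2 + M.a ^ 2) ^ 2
      - M.Δr (x 1) * M.a ^ 2 * Real.sin (x 2) ^ 2 := by
    have h1 : rm ^ 4 ≤ ((x 1) ^ 2 + M.a ^ 2) ^ 2 := by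
      have : rm ^ 2 ≤ x 1 ^ 2 + M.a ^ 2 := by nlinarith [sq_nonneg M.a, hr.1]
      calc rm ^ 4 = (rm ^ 2) ^ 2 := by ring
        _ ≤ _ := by gcongr
    have h2 : M.Δr (x 1) * M.a ^ 2 * Real.sin (x 2) ^ 2 ≤ M.Δr (x 1) * M.a ^ 2 :=
      mul_le_of_le_one_right (by positivity) hs2
    nlinarith [sq_nonneg ((x 1) ^ 2 + M.a ^ 2)]
  rw [M.det_spatial_metric ⟨hr0, hΔ, hs.trans_le hsx⟩]
  refine Real.le_sqrt_of_sq_le ?_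
  rw [div_pow, Real.sq_sqrt (by positivity), div_div]
  -- One of the three powers of E₊ comes from Δ₊(θ) ≤ E₊.
  calc rm ^ 2 * s ^ 2 * (rm ^ 4 / 2) / (4 * M.κ ^ 2 * rp ^ 2 * M.E ^ 3 * (x 1 - rm) ^ 2)
      = rm ^ 2 * s ^ 2 / ((x 1 - rm) ^ 2 * (4 * M.κ ^ 2 * rp ^ 2) * M.E * M.E ^ 2) * (rm ^ 4 / 2) := by
        field_simp
    _ ≤ _ := by
        gcongr

/-- On a small box at the horizon the radial energy and one angular factor are bounded below and S₊
above, so |Ψ| is bounded below there, while the volume integrand dominates 1/(r - r₋). -/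
theorem exists_sliceVolume_eq_top {rm rp ω : ℝ} {k : ℤ} {Xp Xm Yp Ym : ℝ → ℂ}
    {Ψ : (Fin 4 → ℝ) → Fin 4 → ℂ} (hext : M.IsExtreme rm rp)
    (hΔ : ∀ r ∈ Set.Ioo rm rp, 0 < M.Δr r)
    (hform : ∀ x ∈ exterior rm rp, Ψ x = (M.S x)⁻¹ *ᵥ Φ ω k Xp Xm Yp Ym x)
    {c : ℝ} (hc : 0 < c)
    (hX : ∀ᶠ r in nhdsWithin rm (Set.Ioi rm), c ≤ ‖Xp r‖ ^ 2 + ‖Xm r‖ ^ 2)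
    {θ : ℝ} (hθ : θ ∈ Set.Ioo 0 Real.pi)
    (hY : (Ym θ ≠ 0 ∧ ContinuousAt Ym θ) ∨ (Yp θ ≠ 0 ∧ ContinuousAt Yp θ)) (t : ℝ) :
    ∃ b > 0, M.sliceVolume rm rp t
      {y | b ≤ ‖(WithLp.toLp 2 (Ψ (slicePoint t y)) : EuclideanSpace ℂ (Fin 4))‖} = ⊤ := by
  have hrm := hext.1
  have hcont : Continuous M.Δr := M.differentiable_Δr.continuous
  have hΔrm : M.Δr rm = 0 := by rw [hext.Δr_eq]; ring
  -- Δ₊(r) < 1 serves the bound on S₊, and the bound on a²Δ₊(r) serves the volume density.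
  have hev : ∀ᶠ r in nhdsWithin rm (Set.Ioi rm), c ≤ ‖Xp r‖ ^ 2 + ‖Xm r‖ ^ 2 ∧
      M.Δr r < 1 ∧ M.a ^ 2 * M.Δr r < rm ^ 4 / 2 ∧ r < rp := by
    refine hX.and (Filter.Eventually.filter_mono nhdsWithin_le_nhds ?_)
    refine (hcont.continuousAt.eventually_lt continuousAt_const (by simp [hΔrm])).and
      (((hcont.const_mul _).continuousAt.eventually_lt continuousAt_const ?_).and
        (eventually_lt_nhds hext.2.1))
    rw [hΔrm, mul_zero]
    positivity
  obtain ⟨r₁, hr₁, hsub⟩ := mem_nhdsGT_iff_exists_Ioo_subset.1 hev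
  obtain ⟨δ, hδ⟩ : ∃ δ, δ = min r₁ rp - rm := ⟨_, rfl⟩
  have hδ0 : 0 < δ := by rw [hδ, sub_pos]; exact lt_min hr₁ hext.2.1
  have hδ₁ : rm + δ ≤ r₁ := by rw [hδ]; linarith [min_le_left r₁ rp]
  have hδp : rm + δ ≤ rp := by rw [hδ]; linarith [min_le_right r₁ rp]
  have hs0 : 0 < Real.sin θ := Real.sin_pos_of_pos_of_lt_pi hθ.1 hθ.2
  obtain ⟨y₀, hy₀, hYev⟩ : ∃ y₀ > 0, ∀ᶠ ϑ in nhds θ,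
      y₀ ≤ ‖Ym ϑ‖ ^ 2 ∨ y₀ ≤ ‖Yp ϑ‖ ^ 2 := by
    have key : ∀ {Y : ℝ → ℂ}, Y θ ≠ 0 → ContinuousAt Y θ →
        ∀ᶠ ϑ in nhds θ, ‖Y θ‖ ^ 2 / 2 < ‖Y ϑ‖ ^ 2 := fun {Y} h0 h1 => by
      have : 0 < ‖Y θ‖ ^ 2 := by have := norm_pos_iff.2 h0; positivity
      exact (h1.norm.pow 2).tendsto.eventually_const_lt (half_lt_self this)
    rcases hY with ⟨h0, h1⟩ | ⟨h0, h1⟩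
    · exact ⟨‖Ym θ‖ ^ 2 / 2, by have := norm_pos_iff.2 h0; positivity, (key h0 h1).mono fun ϑ h =>
        Or.inl h.le⟩
    · exact ⟨‖Yp θ‖ ^ 2 / 2, by have := norm_pos_iff.2 h0; positivity, (key h0 h1).mono fun ϑ h =>
        Or.inr h.le⟩
  have hθev : ∀ᶠ ϑ in nhds θ, (y₀ ≤ ‖Ym ϑ‖ ^ 2 ∨ y₀ ≤ ‖Yp ϑ‖ ^ 2) ∧ Real.sin θ / 2 < Real.sin ϑ :=
    hYev.and
      (Real.continuous_sin.continuousAt.tendsto.eventually_const_lt (by linarith))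
  obtain ⟨l, u, hlu, hsubθ⟩ := mem_nhds_iff_exists_Ioo_subset.1
    (Filter.inter_mem hθev (Ioo_mem_nhds hθ.1 hθ.2))
  set θ₁ := max l 0 with hθ₁
  set θ₂ := min u Real.pi with hθ₂
  have hθ₁₂ : θ₁ < θ₂ := (max_lt hlu.1 hθ.1).trans (lt_min hlu.2 hθ.2)
  have hθsub : ∀ ϑ ∈ Set.Ioo θ₁ θ₂, ((y₀ ≤ ‖Ym ϑ‖ ^ 2 ∨ y₀ ≤ ‖Yp ϑ‖ ^ 2) ∧
      Real.sin θ / 2 < Real.sin ϑ) ∧ ϑ ∈ Set.Ioo 0 Real.pi := fun ϑ h =>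
    hsubθ ⟨(le_max_left _ _).trans_lt h.1, h.2.trans_le (min_le_left _ _)⟩
  have hrsub : ∀ r ∈ Set.Ioo rm (rm + δ), r ∈ Set.Ioo rm rp ∧ c ≤ ‖Xp r‖ ^ 2 + ‖Xm r‖ ^ 2 ∧
      M.Δr r < 1 ∧ M.a ^ 2 * M.Δr r < rm ^ 4 / 2 ∧ r < rp := fun r h =>
    ⟨⟨h.1, h.2.trans_le hδp⟩, hsub ⟨h.1, h.2.trans_le hδ₁⟩⟩
  have hrp : 0 < rp := hrm.trans hext.2.1
  have hE := M.E_pos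
  have hκ := M.κ_pos
  have hC : 0 < rp + |M.a| := by positivity
  refine ⟨√(c * y₀ / (rp + |M.a|)), Real.sqrt_pos.2 (by positivity), ?_⟩
  refine MeasureTheory.measure_mono_top ?_ (M.sliceVolume_eq_top (t := t) (θ₁ := θ₁) (θ₂ := θ₂)
    (c := √(rm ^ 2 * (Real.sin θ / 2) ^ 2 * (rm ^ 4 / 2) / (4 * M.κ ^ 2 * rp ^ 2 * M.E ^ 3)))
    hδ0 hδp (Real.sqrt_pos.2 (by positivity)) (le_max_right _ _) hθ₁₂ (min_le_right _ _) ?_)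
  · rintro ⟨r, ϑ, φ⟩ ⟨hr, hϑ, hφ⟩
    obtain ⟨hrI, hN, hΔ1, -, -⟩ := hrsub r hr
    obtain ⟨⟨hYϑ, -⟩, hϑI⟩ := hθsub ϑ hϑ
    have hmem : slicePoint t (r, ϑ, φ) ∈ exterior rm rp := ⟨hrI, hϑI, hφ⟩
    obtain ⟨e0, e1, e2, e3⟩ := M.components_eq hrm hΔ hform hmem
    have hr0 : 0 < r := hrm.trans hrI.1
    have hσ : ∀ ε : ℝ, |ε| = 1 → ‖M.scale ε r ϑ‖ ^ 2 ≤ rp + |M.a| := fun ε hε => by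
      refine (M.norm_scale_sq_le hr0 hrI.2.le (hΔ r hrI) hε ϑ).trans ?_
      exact mul_le_of_le_one_left hC.le (Real.sqrt_le_one.2 hΔ1.le)
    have hbound : c * y₀ ≤ (rp + |M.a|)
        * ‖(WithLp.toLp 2 (Ψ (slicePoint t (r, ϑ, φ))) : EuclideanSpace ℂ (Fin 4))‖ ^ 2 := by
      rcases hYϑ with hYϑ | hYϑ
      · refine le_trans ?_ (le_norm_spinor_sq (i := 2) (j := 0) (by decide) (norm_phase _ _ _ _) e2 e0
          (hσ (-1) (by simp)) (hσ 1 (by simp)))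
        exact mul_le_mul hN hYϑ hy₀.le (by positivity)
      · refine le_trans ?_ (le_norm_spinor_sq (i := 1) (j := 3) (by decide) (norm_phase _ _ _ _) e1 e3
          (hσ 1 (by simp)) (hσ (-1) (by simp)))
        exact mul_le_mul hN hYϑ hy₀.le (by positivity)
    refine Real.sqrt_le_iff.2 ⟨norm_nonneg _, ?_⟩
    rwa [div_le_iff₀' hC]
  · intro r hr ϑ hϑ φ
    obtain ⟨hrI, -, -, hsmall, -⟩ := hrsub r hr
    obtain ⟨⟨-, hs⟩, -⟩ := hθsub ϑ hϑ
    exact M.le_sqrt_det_spatial_metric hext (x := slicePoint t (r, ϑ, φ)) hrI (by positivity) hs.le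
      hsmall.le (hΔ r hrI)

end KNdS

end

theorem theorem4p1 (M : KNdS) (rm rp : ℝ) (hext : M.IsExtreme rm rp)
    (lam ω : ℝ) (k : ℤ) (Xp Xm Yp Ym : ℝ → ℂ) (Ψ : (Fin 4 → ℝ) → Fin 4 → ℂ)
    (hform : ∀ x ∈ KNdS.exterior rm rp, Ψ x = (M.S x)⁻¹ *ᵥ KNdS.Φ ω k Xp Xm Yp Ym x)
    (hsol : M.IsDiracSolution lam rm rp Ψ)
    (hne : ∃ x ∈ KNdS.exterior rm rp, Ψ x ≠ 0)
    (hLp : ∃ p : ℝ, 1 ≤ p ∧ ∃ t : ℝ, M.MemLpSlice p rm rp t Ψ) :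
    ω * (rm ^ 2 + M.a ^ 2) + (k + 1 / 2) * M.E * M.a + rm * M.Q = 0 := by
  by_contra hK
  have hrm := hext.1
  have hκ := M.κ_pos
  have hh : ∀ r ∈ Set.Ico rm rp, 0 < M.κ ^ 2 * (rp - r) * (r + 2 * rm + rp) := fun r hr => by
    have h1 : 0 < rp - r := sub_pos.2 hr.2
    have h2 : 0 < r + 2 * rm + rp := by linarith [hr.1, hr.2]
    positivity
  have hΔ : ∀ r ∈ Set.Ioo rm rp, 0 < M.Δr r := fun r hr => by
    rw [hext.Δr_eq]
    have h1 : 0 < r - rm := sub_pos.2 hr.1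
    have h2 := hh r ⟨hr.1.le, hr.2⟩
    positivity
  obtain ⟨x, hx, hΨx⟩ := hne
  obtain ⟨hX, hY⟩ := M.exists_angular_ne_zero hrm hΔ hform hsol hx hΨx
  obtain ⟨μ, hode⟩ := M.radial_ode hrm hΔ hform hsol hx.2.1
    (hY.imp (fun h => h.1) (fun h => h.1))
  -- the square root of `Δr`, continued smoothly through the double root
  set p : ℝ → ℝ := fun r => (r - rm) * √(M.κ ^ 2 * (rp - r) * (r + 2 * rm + rp)) with hp
  have hpΔ : ∀ r ∈ Set.Ioo rm rp, √(M.Δr r) = p r := fun r hr => by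
    rw [hext.Δr_eq, Real.sqrt_mul (sq_nonneg _), Real.sqrt_sq (sub_pos.2 hr.1).le]
  have hp2 : ∀ r ∈ Set.Ioo rm rp, M.Δr r = p r ^ 2 := fun r hr => by
    rw [← hpΔ r hr, Real.sq_sqrt (hΔ r hr).le]
  have hpd : ContDiffAt ℝ 1 p rm := by
    refine ContDiffAt.mul (by fun_prop) (ContDiffAt.sqrt (by fun_prop) ?_)
    exact (hh rm ⟨le_rfl, hext.2.1⟩).ne'
  obtain ⟨c, hc, hlow⟩ := KNdS.radial_lower_bound (K := M.radialK ω k) (p := p)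
    (β₁ := fun r => μ + Complex.I * lam * r) (β₂ := fun r => μ - Complex.I * lam * r)
    (fun r hr => by have := (hode r hr).1; rwa [hpΔ r hr, hp2 r hr] at this)
    (fun r hr => by have := (hode r hr).2; rwa [hpΔ r hr, hp2 r hr] at this)
    (contDiff_const.add (contDiff_const.mul Complex.ofRealCLM.contDiff))
    (contDiff_const.sub (contDiff_const.mul Complex.ofRealCLM.contDiff))
    (by unfold KNdS.radialK; fun_prop) hpd (by fun_prop)
    (fun r hr => by rw [← hpΔ r hr]; exact (Real.sqrt_pos.2 (hΔ r hr)).ne')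
    (by simp [hp]) hK hx.1 hX
  obtain ⟨q, hq, t, hmem⟩ := hLp
  obtain ⟨b, hb, htop⟩ := M.exists_sliceVolume_eq_top hext hΔ hform hc hlow hx.2.1 hY t
  -- Chebyshev: an L^q function with 0 < q < ∞ has superlevel sets of finite measure.
  have hfin := hmem.meas_ge_lt_top (by simpa using (by linarith : 0 < q)) ENNReal.ofReal_ne_top
    (ε := ⟨b, hb.le⟩) fun h => hb.ne' (congrArg NNReal.toReal h)
  exact hfin.ne htop
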